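/- Let $I,J\subseteq\mathbb R$ and $U_k\subseteq\mathbb R$ $(k\ge 0)$ be nonempty open intervals with $0\notin U_0$. Let $\Omega$ be the set of points $(t,x,u,u_1,u_2,\dots)$ with $t\in I$, $x\in J$, $u=u_0\in U_0$ and $u_k\in U_k$ for all $k\ge1$ (here $u_1=u_x$, $u_2=u_{xx}$, etc.). A differential function on $\Omega$ is a smooth function of $t,x$ and finitely many of the $u_k$. For a smooth function $\beta(t,x)$ on $I\times J$ consider the equation $$u_t=F:=\beta_x u^2u_{xx}+2\beta_{xx}u^2u_x+4\beta u_x+(\beta_{xxx}-4\beta_x)u^3-4\beta_x u ,\qquad (\ast)$$ and the total derivatives $D_x=\partial_x+\sum_k u_{k+1}\partial_{u_k}$ and $D_t=\partial_t+\sum_k (D_x^kF)\,\partial_{u_k}$. A local conservation law of $(\ast)$ is a pair $(\rho,\sigma)$ of differential functions on $\Omega$ with $D_t\rho=D_x\sigma$ on $\Omega$. It is trivial if $\rho=D_xf$ and $\sigma=D_tf$ for some differential function $f$ on $\Omega$. (1) Suppose that $\beta_x\neq0$ everywhere on $I\times J$. Then $(\ast)$ has a nontrivial local conservation law if and only if there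 are smooth functions $p,q$ of $t\in I$ such that $(pq)_t\ne0$ everywhere on $I$, $pe^{2x}-qe^{-2x}\neq0$ everywhere on $I\times J$, and $$\beta=\frac18\,\frac{p_te^{2x}+q_te^{-2x}}{pe^{2x}-qe^{-2x}}\quad\text{on } I\times J.\qquad(\ast\ast)$$ (2) If $p,q$ are smooth functions on $I$ with $(pq)_t\ne0$ everywhere on $I$ and $pe^{2x}-qe^{-2x}\ne0$ everywhere on $I\times J$, and $\beta$ is given by $(\ast\ast)$, then $\beta$ is smooth with $\beta_x\ne0$ everywhere on $I\times J$, and $(\ast)$ has exactly one nontrivial local conservation law up to constant multiples and trivial conservation laws, namely $$D_t\frac{pe^{2x}+qe^{-2x}}{u}=D_x\Big(\frac12\frac{(pq)_t(pe^{2x}+qe^{-2x})}{(pe^{2x}-qe^{-2x})^2}u_x+\frac12\frac{(p_te^{2x}+q_te^{-2x})(pe^{2x}+qe^{-2x})}{pe^{2x}-qe^{-2x}}\frac1u-\frac{(pq)_t(3p^2e^{4x}+2pq+3q^2e^{-4x})}{(pe^{2x}-qe^{-2x})^3}u\Big).$$ That is, this law holds and is nontrivial, and for every local conservation law $(\rho,\sigma)$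 there is a unique constant $c\in\mathbb R$ such that $(\rho,\sigma)$ minus $c$ times this law is trivial. -/

import Mathlib

open scoped ContDiff

noncomputable section

/-- A point of the equation manifold of a scalar evolution equation: the coordinates are `t`, `x`
and the jet coordinates `u 0 = u`, `u 1 = u_x`, `u 2 = u_xx`, and so on. -/
structure JetPoint where
  t : ℝ
  x : ℝ
  u : ℕ → ℝ

namespace JetPoint

/-- The partial derivative with respect to `t`. -/
def dt (f : JetPoint → ℝ) (z : JetPoint) : ℝ :=
  deriv (fun s => f ⟨s, z.x, z.u⟩) z.t

/-- The partial derivative with respect to `x`. -/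
def dx (f : JetPoint → ℝ) (z : JetPoint) : ℝ :=
  deriv (fun s => f ⟨z.t, s, z.u⟩) z.x

/-- The partial derivative with respect to the jet coordinate `u k`. -/
def du (k : ℕ) (f : JetPoint → ℝ) (z : JetPoint) : ℝ :=
  deriv (fun s => f ⟨z.t, z.x, Function.update z.u k s⟩) (z.u k)

/-- The total derivative `D_x = ∂/∂x + ∑ u_{k+1} ∂/∂u_k`. The sum is finite for functions that
depend on finitely many jet coordinates. -/
def totalDx (f : JetPoint → ℝ) (z : JetPoint) : ℝ :=
  dx f z + ∑ᶠ k : ℕ, z.u (k + 1) * du k f z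

/-- The total derivative `D_t = ∂/∂t + ∑ (D_x^k F) ∂/∂u_k` along the equation `u_t = F`. -/
def totalDt (F f : JetPoint → ℝ) (z : JetPoint) : ℝ :=
  dt f z + ∑ᶠ k : ℕ, (totalDx^[k] F) z * du k f z

end JetPoint

/-- A coordinate box in the equation manifold: `t`, `x` and each jet coordinate `u k` range over
nonempty open intervals (bounded or not). -/
structure JetBox where
  I : Set ℝ
  J : Set ℝ
  U : ℕ → Set ℝ
  isOpen_I : IsOpen I
  isOpen_J : IsOpen J
  isOpen_U : ∀ k, IsOpen (U k)
  ordConnected_I : I.OrdConnected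
  ordConnected_J : J.OrdConnected
  ordConnected_U : ∀ k, (U k).OrdConnected
  nonempty_I : I.Nonempty
  nonempty_J : J.Nonempty
  nonempty_U : ∀ k, (U k).Nonempty

namespace JetBox

/-- The points of the box. -/
def carrier (B : JetBox) : Set JetPoint :=
  {z | z.t ∈ B.I ∧ z.x ∈ B.J ∧ ∀ k, z.u k ∈ B.U k}

/-- The projection of the box to the coordinates `t, x, u_0, …, u_{n-1}`. -/
def finiteBox (B : JetBox) (n : ℕ) : Set (ℝ × ℝ × (Fin n → ℝ)) :=
  {y | y.1 ∈ B.I ∧ y.2.1 ∈ B.J ∧ ∀ i : Fin n, y.2.2 i ∈ B.U i}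

/-- `f` is a smooth function on the box, depending on finitely many jet coordinates
(a differential function). -/
def IsDifferentialFunction (B : JetBox) (f : JetPoint → ℝ) : Prop :=
  ∃ (n : ℕ) (g : ℝ × ℝ × (Fin n → ℝ) → ℝ), ContDiffOn ℝ ∞ g (B.finiteBox n) ∧
    ∀ z ∈ B.carrier, f z = g (z.t, z.x, fun i => z.u i)

/-- `D_t ρ = D_x σ` holds on the box as a consequence of `u_t = F`, that is, `ρ` and `σ` are the
density and the flux of a (possibly trivial) local conservation law. -/
structure IsConservationLaw (B : JetBox) (F ρ σ : JetPoint → ℝ) : Prop where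
  density : B.IsDifferentialFunction ρ
  flux : B.IsDifferentialFunction σ
  law : ∀ z ∈ B.carrier, JetPoint.totalDt F ρ z = JetPoint.totalDx σ z

/-- The conservation law with density `ρ` and flux `σ` is trivial: `ρ = D_x f` and `σ = D_t f` for
a differential function `f` on the box. -/
def IsTrivialLaw (B : JetBox) (F ρ σ : JetPoint → ℝ) : Prop :=
  ∃ f : JetPoint → ℝ, B.IsDifferentialFunction f ∧
    ∀ z ∈ B.carrier, ρ z = JetPoint.totalDx f z ∧ σ z = JetPoint.totalDt F f z

/-- The parameter `β` of the class: a smooth function of `t, x` with `∂β/∂x ≠ 0`. -/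
structure IsParameter (B : JetBox) (β : ℝ → ℝ → ℝ) : Prop where
  smooth : ContDiffOn ℝ ∞ (fun y : ℝ × ℝ => β y.1 y.2) (B.I ×ˢ B.J)
  deriv_ne_zero : ∀ t ∈ B.I, ∀ x ∈ B.J, deriv (β t) x ≠ 0

/-- `β = (1/8) (p_t e^{2x} + q_t e^{-2x}) / (p e^{2x} - q e^{-2x})`, with smooth functions `p, q`
of `t` such that `(pq)_t ≠ 0`, the denominator having no zeros. -/
structure IsSpecialParameter (B : JetBox) (β : ℝ → ℝ → ℝ) (p q : ℝ → ℝ) : Prop where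
  smooth_p : ContDiffOn ℝ ∞ p B.I
  smooth_q : ContDiffOn ℝ ∞ q B.I
  deriv_mul_ne_zero : ∀ t ∈ B.I, deriv (fun s => p s * q s) t ≠ 0
  denom_ne_zero : ∀ t ∈ B.I, ∀ x ∈ B.J,
    p t * Real.exp (2 * x) - q t * Real.exp (-2 * x) ≠ 0
  eq : ∀ t ∈ B.I, ∀ x ∈ B.J,
    β t x = 1 / 8 * ((deriv p t * Real.exp (2 * x) + deriv q t * Real.exp (-2 * x)) /
      (p t * Real.exp (2 * x) - q t * Real.exp (-2 * x)))

end JetBox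

/-- The right-hand side of the equation with parameter `β`:
`β_x u² u_xx + 2 β_xx u² u_x + 4 β u_x + (β_xxx - 4 β_x) u³ - 4 β_x u`. -/
def evolutionRHS (β : ℝ → ℝ → ℝ) (z : JetPoint) : ℝ :=
  deriv (β z.t) z.x * z.u 0 ^ 2 * z.u 2
    + 2 * iteratedDeriv 2 (β z.t) z.x * z.u 0 ^ 2 * z.u 1
    + 4 * β z.t z.x * z.u 1
    + (iteratedDeriv 3 (β z.t) z.x - 4 * deriv (β z.t) z.x) * z.u 0 ^ 3
    - 4 * deriv (β z.t) z.x * z.u 0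

/-- The density `(p e^{2x} + q e^{-2x}) / u`. -/
def specialDensity (p q : ℝ → ℝ) (z : JetPoint) : ℝ :=
  (p z.t * Real.exp (2 * z.x) + q z.t * Real.exp (-2 * z.x)) / z.u 0

/-- The flux of the explicit conservation law. -/
def specialFlux (p q : ℝ → ℝ) (z : JetPoint) : ℝ :=
  1 / 2 * (deriv (fun s => p s * q s) z.t
        * (p z.t * Real.exp (2 * z.x) + q z.t * Real.exp (-2 * z.x))
      / (p z.t * Real.exp (2 * z.x) - q z.t * Real.exp (-2 * z.x)) ^ 2) * z.u 1
    + 1 / 2 * ((deriv p z.t * Real.exp (2 * z.x) + deriv q z.t * Real.exp (-2 * z.x))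
        * (p z.t * Real.exp (2 * z.x) + q z.t * Real.exp (-2 * z.x))
      / (p z.t * Real.exp (2 * z.x) - q z.t * Real.exp (-2 * z.x))) * (1 / z.u 0)
    - deriv (fun s => p s * q s) z.t
        * (3 * p z.t ^ 2 * Real.exp (4 * z.x) + 2 * p z.t * q z.t
          + 3 * q z.t ^ 2 * Real.exp (-4 * z.x))
      / (p z.t * Real.exp (2 * z.x) - q z.t * Real.exp (-2 * z.x)) ^ 3 * z.u 0

end

/-! Write `SmoothLT n` for smooth functions of t, x and u_0, …, u_{n-1}; thus `SmoothLT 0` means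
functions of t and x alone. The right-hand side F is affine in u_xx with leading coefficient a = β_x
u², which vanishes nowhere.

Order reduction. If a density ρ depends on u_0, …, u_K with K ≥ 1, comparing the terms of D_tρ =
D_xσ that are quadratic in u_{K+1} gives a ρ_{u_K u_K} = 0 (`pd_pd_density_eq_zero`). Hence ρ is
affine in u_K, and subtracting a suitable D_xG removes u_K. After finitely many steps ρ = ρ(t, x,
u).

Determining equations. For such ρ the law becomes a polynomial identity in u_x (`determining`). It
forces β_x u² ρ_u to be free of u, so ρ = h(t, x)/u + g(t, x), and g is a total x-derivative. The
rest amounts to h_xx = 4h and h_t = 4β h_x (`div_u_equations`). Conversely each solution h gives a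
law (`isConservationLaw_div_u`), which is nontrivial unless h = 0.

Rigidity. Cross-differentiating the two equations expresses h as a multiple of h_x, so y = h_x
satisfies homogeneous linear first-order equations in t and in x. One zero of h_x therefore forces h
= 0 (`eq_zero_of_pd_x_eq_zero`), and the solution space is at most one-dimensional. This yields
uniqueness of the law up to multiples, and for h ≠ 0 it makes h_x nowhere zero.

Solution. From h_xx = 4h one gets h = p e^{2x} + q e^{-2x} with p, q depending on t; dividing h_t by
4h_x gives the stated β. For that β, β_x = -(pq)_t / (2(p e^{2x} - q e^{-2x})²), so β_x ≠ 0 and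
(pq)_t ≠ 0 are equivalent. -/

noncomputable section

/-! ### Smooth dependence of an integral over [0, 1] on parameters. -/

section ParametricIntegral

open Set MeasureTheory intervalIntegral

variable {E : Type} [NormedAddCommGroup E] [NormedSpace ℝ E]
  {S : Set E} {W : Set (E × ℝ)}

theorem hasFDerivAt_integral_zero_one {F : Type} [NormedAddCommGroup F] [NormedSpace ℝ F]
    [CompleteSpace F] (hW : IsOpen W) (hSW : ∀ y ∈ S, ∀ θ ∈ Icc (0 : ℝ) 1, (y, θ) ∈ W)
    {f : E × ℝ → F} (hf : ContDiffOn ℝ ∞ f W) {y : E} (hy : y ∈ S) :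
    HasFDerivAt (fun y => ∫ θ in (0 : ℝ)..1, f (y, θ))
      (∫ θ in (0 : ℝ)..1, (fderiv ℝ f (y, θ)).comp (ContinuousLinearMap.inl ℝ E ℝ)) y := by
  set D : E × ℝ → (E →L[ℝ] F) := fun w => (fderiv ℝ f w).comp (ContinuousLinearMap.inl ℝ E ℝ)
    with hD
  have hDc : ContinuousOn D W :=
    (hf.continuousOn_fderiv_of_isOpen hW (by simp)).clm_comp continuousOn_const
  have hIoc : uIoc (0 : ℝ) 1 ⊆ Icc 0 1 := by
    rw [uIoc_of_le zero_le_one]; exact Ioc_subset_Icc_self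
  have hslice : ∀ y' : E, ContinuousOn (fun θ : ℝ => (y', θ)) (Icc 0 1) := fun y' => by fun_prop
  have hK : IsCompact ((fun θ : ℝ => ‖D (y, θ)‖) '' Icc 0 1) := by
    refine isCompact_Icc.image_of_continuousOn (ContinuousOn.norm ?_)
    exact hDc.comp (hslice y) fun θ hθ => hSW y hy θ hθ
  obtain ⟨C, hC⟩ := hK.bddAbove
  have hW' : IsOpen (W ∩ (fun w => ‖D w‖) ⁻¹' Iio (C + 1)) :=
    hDc.norm.isOpen_inter_preimage hW isOpen_Iio
  -- The derivative is bounded by C on the compact segment over y; the tube lemma extends the strict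
  -- bound C + 1 to a neighbourhood of y, uniformly in θ, which is the domination needed.
  obtain ⟨u, v, hu, -, hyu, hv, huv⟩ := generalized_tube_lemma (isCompact_singleton (x := y))
    (isCompact_Icc (a := (0 : ℝ)) (b := 1)) hW' (by
      rintro ⟨y', θ⟩ ⟨hy', hθ⟩
      obtain rfl : y' = y := hy'
      refine ⟨hSW _ hy θ hθ, ?_⟩
      have := hC ⟨θ, hθ, rfl⟩
      simp only [mem_preimage, mem_Iio] at this ⊢
      linarith)
  have hun : u ∈ nhds y := hu.mem_nhds (hyu rfl)
  have huW : ∀ y' ∈ u, ∀ θ ∈ Icc (0 : ℝ) 1, (y', θ) ∈ W ∧ ‖D (y', θ)‖ < C + 1 :=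
    fun y' hy' θ hθ => huv ⟨hy', hv hθ⟩
  have hfc : ∀ y' ∈ u, ContinuousOn (fun θ : ℝ => f (y', θ)) (Icc 0 1) := fun y' hy' =>
    hf.continuousOn.comp (hslice y') fun θ hθ => (huW y' hy' θ hθ).1
  refine hasFDerivAt_integral_of_dominated_of_fderiv_le (F' := fun y' θ => D (y', θ))
    (bound := fun _ => C + 1) hun ?_ ?_ ?_ ?_ intervalIntegrable_const ?_
  · filter_upwards [hun] with y' hy'
    exact ((hfc y' hy').mono hIoc).aestronglyMeasurable measurableSet_uIoc
  · refine ContinuousOn.intervalIntegrable ?_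
    rw [uIcc_of_le zero_le_one]
    exact hfc y (hyu rfl)
  · refine ContinuousOn.aestronglyMeasurable ?_ measurableSet_uIoc
    exact hDc.comp ((hslice y).mono hIoc) fun θ hθ => hSW y hy θ (hIoc hθ)
  · exact Filter.Eventually.of_forall fun θ hθ y' hy' => (huW y' hy' θ (hIoc hθ)).2.le
  · refine Filter.Eventually.of_forall fun θ hθ y' hy' => ?_
    have hd : HasFDerivAt f (fderiv ℝ f (y', θ)) (y', θ) :=
      ((hf.contDiffAt (hW.mem_nhds (huW y' hy' θ (hIoc hθ)).1)).differentiableAt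
        (by simp)).hasFDerivAt
    exact hd.comp y' (hasFDerivAt_prodMk_left y' θ)

/-- Each derivative is again an integral of the same kind, with values in continuous linear maps;
the codomain is therefore quantified inside the induction. -/
theorem contDiffOn_integral_zero_one (hS : IsOpen S) (hW : IsOpen W)
    (hSW : ∀ y ∈ S, ∀ θ ∈ Icc (0 : ℝ) 1, (y, θ) ∈ W) (n : ℕ) :
    ∀ {F : Type} [NormedAddCommGroup F] [NormedSpace ℝ F] [CompleteSpace F] {f : E × ℝ → F},
      ContDiffOn ℝ ∞ f W → ContDiffOn ℝ n (fun y => ∫ θ in (0 : ℝ)..1, f (y, θ)) S := by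
  induction n with
  | zero =>
    intro F _ _ _ f hf
    rw [Nat.cast_zero, contDiffOn_zero]
    exact fun y hy =>
      (hasFDerivAt_integral_zero_one hW hSW hf hy).continuousAt.continuousWithinAt
  | succ n ih =>
    intro F _ _ _ f hf
    rw [Nat.cast_succ, contDiffOn_succ_iff_fderiv_of_isOpen hS]
    refine ⟨fun y hy => (hasFDerivAt_integral_zero_one hW hSW hf
      hy).differentiableAt.differentiableWithinAt, by simp, ?_⟩
    have h1 : ContDiffOn ℝ ∞
        (fun w => (fderiv ℝ f w).comp (ContinuousLinearMap.inl ℝ E ℝ)) W :=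
      (((contDiffOn_infty_iff_fderiv_of_isOpen hW).1 hf).2).clm_comp contDiffOn_const
    exact (ih h1).congr fun y hy => (hasFDerivAt_integral_zero_one hW hSW hf hy).fderiv

end ParametricIntegral

/-! ### Jet coordinates, and smooth functions of finitely many of them. -/

/-- The coordinates on the jet space. -/
inductive JetCoord
  | t
  | x
  | u (k : ℕ)

namespace JetPoint

/-- The value of a coordinate. -/
def get (z : JetPoint) : JetCoord → ℝ
  | .t => z.t
  | .x => z.x
  | .u k => z.u k

/-- The point with one coordinate replaced. -/
def set (z : JetPoint) : JetCoord → ℝ → JetPoint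
  | .t, s => ⟨s, z.x, z.u⟩
  | .x, s => ⟨z.t, s, z.u⟩
  | .u k, s => ⟨z.t, z.x, Function.update z.u k s⟩

/-- The partial derivative with respect to a coordinate. -/
def pd (i : JetCoord) (f : JetPoint → ℝ) (z : JetPoint) : ℝ :=
  deriv (fun s => f (z.set i s)) (z.get i)

@[simp] theorem set_get (z : JetPoint) (i : JetCoord) : z.set i (z.get i) = z := by
  cases i <;> simp [set, get]

@[simp] theorem get_set (z : JetPoint) (i : JetCoord) (s : ℝ) : (z.set i s).get i = s := by
  cases i <;> simp [set, get]

theorem get_set_of_ne (z : JetPoint) {i j : JetCoord} (h : j ≠ i) (s : ℝ) :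
    (z.set i s).get j = z.get j := by
  cases i <;> cases j <;> simp_all [set, get]

@[simp] theorem set_set (z : JetPoint) (i : JetCoord) (s r : ℝ) :
    (z.set i s).set i r = z.set i r := by
  cases i <;> simp [set]

/-- The coordinates `t, x, u 0, …, u (n - 1)` of a point. -/
def proj (n : ℕ) (z : JetPoint) : ℝ × ℝ × (Fin n → ℝ) := (z.t, z.x, fun i => z.u i)

end JetPoint

open JetPoint

/-- The direction in which a coordinate increases, in the space of the first coordinates. -/
def JetCoord.dir (n : ℕ) : JetCoord → ℝ × ℝ × (Fin n → ℝ)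
  | .t => (1, 0, 0)
  | .x => (0, 1, 0)
  | .u k => (0, 0, fun i => if (i : ℕ) = k then 1 else 0)

theorem JetPoint.proj_set (n : ℕ) (z : JetPoint) (i : JetCoord) (s : ℝ) :
    proj n (z.set i s) = proj n z + (s - z.get i) • i.dir n := by
  cases i with
  | t => simp [proj, set, get, JetCoord.dir]
  | x => simp [proj, set, get, JetCoord.dir]
  | u k =>
    simp only [proj, set, get, JetCoord.dir, Prod.smul_mk, Prod.mk_add_mk, smul_zero, add_zero]
    congr 2
    funext j
    by_cases h : (j : ℕ) = k
    · subst h; simp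
    · simp [h]

namespace JetBox

variable {B : JetBox}

/-- The interval in which a coordinate ranges. -/
def range (B : JetBox) : JetCoord → Set ℝ
  | .t => B.I
  | .x => B.J
  | .u k => B.U k

theorem isOpen_range (i : JetCoord) : IsOpen (B.range i) := by
  cases i
  exacts [B.isOpen_I, B.isOpen_J, B.isOpen_U _]

theorem ordConnected_range (i : JetCoord) : (B.range i).OrdConnected := by
  cases i
  exacts [B.ordConnected_I, B.ordConnected_J, B.ordConnected_U _]

theorem nonempty_range (i : JetCoord) : (B.range i).Nonempty := by
  cases i
  exacts [B.nonempty_I, B.nonempty_J, B.nonempty_U _]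

theorem convex_range (i : JetCoord) : Convex ℝ (B.range i) := (B.ordConnected_range i).convex

theorem mem_carrier {z : JetPoint} : z ∈ B.carrier ↔ ∀ i, z.get i ∈ B.range i :=
  ⟨fun h i => by cases i; exacts [h.1, h.2.1, h.2.2 _],
    fun h => ⟨h .t, h .x, fun k => h (.u k)⟩⟩

theorem get_mem {z : JetPoint} (hz : z ∈ B.carrier) (i : JetCoord) : z.get i ∈ B.range i :=
  mem_carrier.1 hz i

theorem set_mem {z : JetPoint} (hz : z ∈ B.carrier) {i : JetCoord} {s : ℝ} (hs : s ∈ B.range i) :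
    z.set i s ∈ B.carrier := by
  refine mem_carrier.2 fun j => ?_
  by_cases h : j = i
  · subst h; simpa using hs
  · rw [get_set_of_ne _ h]; exact get_mem hz j

theorem set_mem_iff {z : JetPoint} (hz : z ∈ B.carrier) {i : JetCoord} {s : ℝ} :
    z.set i s ∈ B.carrier ↔ s ∈ B.range i :=
  ⟨fun h => by simpa using get_mem h i, set_mem hz⟩

theorem carrier_nonempty : B.carrier.Nonempty := by
  obtain ⟨t, ht⟩ := B.nonempty_I
  obtain ⟨x, hx⟩ := B.nonempty_J
  choose u hu using B.nonempty_U
  exact ⟨⟨t, x, u⟩, ht, hx, hu⟩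

theorem eventually_set_mem {z : JetPoint} (hz : z ∈ B.carrier) (i : JetCoord) :
    ∀ᶠ s in nhds (z.get i), z.set i s ∈ B.carrier :=
  Filter.Eventually.mono ((isOpen_range i).mem_nhds (get_mem hz i)) fun _ hs => set_mem hz hs

theorem isOpen_finiteBox (n : ℕ) : IsOpen (B.finiteBox n) := by
  have : B.finiteBox n = B.I ×ˢ B.J ×ˢ Set.univ.pi fun i : Fin n => B.U i := by
    ext y; simp [finiteBox]
  rw [this]
  exact B.isOpen_I.prod (B.isOpen_J.prod (isOpen_set_pi Set.finite_univ fun i _ => B.isOpen_U i))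

theorem proj_mem {z : JetPoint} (hz : z ∈ B.carrier) (n : ℕ) : proj n z ∈ B.finiteBox n :=
  ⟨hz.1, hz.2.1, fun i => hz.2.2 i⟩

theorem exists_proj_eq {n : ℕ} {y : ℝ × ℝ × (Fin n → ℝ)} (hy : y ∈ B.finiteBox n) :
    ∃ z ∈ B.carrier, proj n z = y := by
  choose u hu using B.nonempty_U
  refine ⟨⟨y.1, y.2.1, fun k => if h : k < n then y.2.2 ⟨k, h⟩ else u k⟩,
    ⟨hy.1, hy.2.1, fun k => ?_⟩, ?_⟩
  · by_cases h : k < n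
    · simpa [h] using hy.2.2 ⟨k, h⟩
    · simpa [h] using hu k
  · simp [proj]

/-- `f` is a smooth function on the box of the coordinates `t, x, u 0, …, u (n - 1)`. -/
def SmoothLT (B : JetBox) (n : ℕ) (f : JetPoint → ℝ) : Prop :=
  ∃ g : ℝ × ℝ × (Fin n → ℝ) → ℝ, ContDiffOn ℝ ∞ g (B.finiteBox n) ∧
    ∀ z ∈ B.carrier, f z = g (proj n z)

theorem SmoothLT.congr {n : ℕ} {f f' : JetPoint → ℝ} (h : B.SmoothLT n f)
    (he : Set.EqOn f' f B.carrier) : B.SmoothLT n f' := by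
  obtain ⟨g, hg, hfg⟩ := h
  exact ⟨g, hg, fun z hz => (he hz).trans (hfg z hz)⟩

theorem SmoothLT.mono {n m : ℕ} {f : JetPoint → ℝ} (h : B.SmoothLT n f) (hnm : n ≤ m) :
    B.SmoothLT m f := by
  obtain ⟨g, hg, hfg⟩ := h
  refine ⟨fun y => g (y.1, y.2.1, fun i => y.2.2 (Fin.castLE hnm i)), ?_, hfg⟩
  refine hg.comp (ContDiff.contDiffOn (by fun_prop)) ?_
  exact fun y hy => ⟨hy.1, hy.2.1, fun i => hy.2.2 (Fin.castLE hnm i)⟩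

theorem SmoothLT.const (n : ℕ) (c : ℝ) : B.SmoothLT n fun _ => c :=
  ⟨fun _ => c, contDiffOn_const, fun _ _ => rfl⟩

theorem SmoothLT.add {n : ℕ} {f f' : JetPoint → ℝ} (h : B.SmoothLT n f) (h' : B.SmoothLT n f') :
    B.SmoothLT n fun z => f z + f' z := by
  obtain ⟨g, hg, hfg⟩ := h
  obtain ⟨g', hg', hfg'⟩ := h'
  exact ⟨fun y => g y + g' y, hg.add hg', fun z hz => by simp only [hfg z hz, hfg' z hz]⟩

theorem SmoothLT.sub {n : ℕ} {f f' : JetPoint → ℝ} (h : B.SmoothLT n f) (h' : B.SmoothLT n f') :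
    B.SmoothLT n fun z => f z - f' z := by
  obtain ⟨g, hg, hfg⟩ := h
  obtain ⟨g', hg', hfg'⟩ := h'
  exact ⟨fun y => g y - g' y, hg.sub hg', fun z hz => by simp only [hfg z hz, hfg' z hz]⟩

theorem SmoothLT.mul {n : ℕ} {f f' : JetPoint → ℝ} (h : B.SmoothLT n f) (h' : B.SmoothLT n f') :
    B.SmoothLT n fun z => f z * f' z := by
  obtain ⟨g, hg, hfg⟩ := h
  obtain ⟨g', hg', hfg'⟩ := h'
  exact ⟨fun y => g y * g' y, hg.mul hg', fun z hz => by simp only [hfg z hz, hfg' z hz]⟩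

theorem SmoothLT.neg {n : ℕ} {f : JetPoint → ℝ} (h : B.SmoothLT n f) :
    B.SmoothLT n fun z => - f z := by
  obtain ⟨g, hg, hfg⟩ := h
  exact ⟨fun y => - g y, hg.neg, fun z hz => by simp only [hfg z hz]⟩

theorem SmoothLT.pow {n : ℕ} {f : JetPoint → ℝ} (h : B.SmoothLT n f) (k : ℕ) :
    B.SmoothLT n fun z => f z ^ k := by
  obtain ⟨g, hg, hfg⟩ := h
  exact ⟨fun y => g y ^ k, hg.pow k, fun z hz => by simp only [hfg z hz]⟩

theorem SmoothLT.div {n : ℕ} {f f' : JetPoint → ℝ} (h : B.SmoothLT n f) (h' : B.SmoothLT n f')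
    (h0 : ∀ z ∈ B.carrier, f' z ≠ 0) : B.SmoothLT n fun z => f z / f' z := by
  obtain ⟨g, hg, hfg⟩ := h
  obtain ⟨g', hg', hfg'⟩ := h'
  refine ⟨fun y => g y / g' y, hg.div hg' fun y hy => ?_, fun z hz => by simp only [hfg z hz, hfg' z hz]⟩
  obtain ⟨z, hz, rfl⟩ := exists_proj_eq hy
  rw [← hfg' z hz]
  exact h0 z hz

theorem SmoothLT.sum {n : ℕ} {ι : Type} {s : Finset ι} {f : ι → JetPoint → ℝ}
    (h : ∀ i ∈ s, B.SmoothLT n (f i)) : B.SmoothLT n fun z => ∑ i ∈ s, f i z := by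
  classical
  induction s using Finset.induction_on with
  | empty => simpa using SmoothLT.const n 0
  | insert a s ha ih =>
    simp only [Finset.sum_insert ha]
    exact (h a (by simp)).add (ih fun i hi => h i (by simp [hi]))

theorem SmoothLT.coord_u {n k : ℕ} (h : k < n) : B.SmoothLT n fun z => z.u k :=
  ⟨fun y => y.2.2 ⟨k, h⟩, ContDiff.contDiffOn (by fun_prop), fun _ _ => rfl⟩

theorem SmoothLT.of_tx {a : ℝ → ℝ → ℝ}
    (h : ContDiffOn ℝ ∞ (fun y : ℝ × ℝ => a y.1 y.2) (B.I ×ˢ B.J)) :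
    B.SmoothLT 0 fun z => a z.t z.x :=
  ⟨fun y => a y.1 y.2.1, h.comp (t := B.I ×ˢ B.J) (f := fun y : ℝ × ℝ × (Fin 0 → ℝ) => (y.1, y.2.1))
    (ContDiff.contDiffOn (by fun_prop)) fun y hy => ⟨hy.1, hy.2.1⟩, fun _ _ => rfl⟩

theorem hasDerivAt_of_rep {n : ℕ} {f : JetPoint → ℝ} {g : ℝ × ℝ × (Fin n → ℝ) → ℝ}
    (hg : ContDiffOn ℝ ∞ g (B.finiteBox n)) (hfg : ∀ z ∈ B.carrier, f z = g (proj n z))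
    (i : JetCoord) {z : JetPoint} (hz : z ∈ B.carrier) :
    HasDerivAt (fun s => f (z.set i s)) (fderiv ℝ g (proj n z) (i.dir n)) (z.get i) := by
  have h1 : HasDerivAt (fun s : ℝ => proj n z + (s - z.get i) • i.dir n)
      ((1 : ℝ) • i.dir n) (z.get i) :=
    (((hasDerivAt_id _).sub_const _).smul_const _).const_add _
  have h2 : HasFDerivAt g (fderiv ℝ g (proj n z)) (proj n z + (z.get i - z.get i) • i.dir n) := by
    rw [sub_self, zero_smul, add_zero]
    exact ((hg.contDiffAt ((isOpen_finiteBox n).mem_nhds (proj_mem hz n))).differentiableAt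
      (by simp)).hasFDerivAt
  have h3 := h2.comp_hasDerivAt (z.get i) h1
  rw [one_smul] at h3
  refine h3.congr_of_eventuallyEq ?_
  filter_upwards [eventually_set_mem hz i] with s hs
  simp [hfg _ hs, proj_set]

theorem SmoothLT.hasDerivAt {n : ℕ} {f : JetPoint → ℝ} (h : B.SmoothLT n f) (i : JetCoord)
    {z : JetPoint} (hz : z ∈ B.carrier) :
    HasDerivAt (fun s => f (z.set i s)) (pd i f z) (z.get i) := by
  obtain ⟨g, hg, hfg⟩ := h
  exact (hasDerivAt_of_rep hg hfg i hz).differentiableAt.hasDerivAt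

theorem SmoothLT.hasDerivAt_set {n : ℕ} {f : JetPoint → ℝ} (h : B.SmoothLT n f) (i : JetCoord)
    {z : JetPoint} (hz : z ∈ B.carrier) {s : ℝ} (hs : s ∈ B.range i) :
    HasDerivAt (fun s => f (z.set i s)) (pd i f (z.set i s)) s := by
  simpa using h.hasDerivAt i (set_mem hz hs)

theorem pd_eq_of_rep {n : ℕ} {f : JetPoint → ℝ} {g : ℝ × ℝ × (Fin n → ℝ) → ℝ}
    (hg : ContDiffOn ℝ ∞ g (B.finiteBox n)) (hfg : ∀ z ∈ B.carrier, f z = g (proj n z))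
    (i : JetCoord) {z : JetPoint} (hz : z ∈ B.carrier) :
    pd i f z = fderiv ℝ g (proj n z) (i.dir n) :=
  (hasDerivAt_of_rep hg hfg i hz).deriv

theorem contDiffOn_fderiv_apply {n : ℕ} {g : ℝ × ℝ × (Fin n → ℝ) → ℝ}
    (hg : ContDiffOn ℝ ∞ g (B.finiteBox n)) (v : ℝ × ℝ × (Fin n → ℝ)) :
    ContDiffOn ℝ ∞ (fun y => fderiv ℝ g y v) (B.finiteBox n) :=
  ((contDiffOn_infty_iff_fderiv_of_isOpen (isOpen_finiteBox n)).1 hg).2.clm_apply contDiffOn_const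

theorem SmoothLT.smooth_pd {n : ℕ} {f : JetPoint → ℝ} (h : B.SmoothLT n f) (i : JetCoord) :
    B.SmoothLT n (pd i f) := by
  obtain ⟨g, hg, hfg⟩ := h
  exact ⟨fun y => fderiv ℝ g y (i.dir n), contDiffOn_fderiv_apply hg _,
    fun z hz => pd_eq_of_rep hg hfg i hz⟩

/-- Values off the box are irrelevant: a small change of one coordinate stays inside it. -/
theorem pd_congr {f f' : JetPoint → ℝ} (h : Set.EqOn f f' B.carrier) (i : JetCoord) :
    Set.EqOn (pd i f) (pd i f') B.carrier := fun _ hz =>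
  Filter.EventuallyEq.deriv_eq ((eventually_set_mem hz i).mono fun _ hs => h hs)

theorem SmoothLT.pd_comm {n : ℕ} {f : JetPoint → ℝ} (h : B.SmoothLT n f) (i j : JetCoord)
    {z : JetPoint} (hz : z ∈ B.carrier) :
    pd i (pd j f) z = pd j (pd i f) z := by
  obtain ⟨g, hg, hfg⟩ := h
  have hc := hg.contDiffAt ((isOpen_finiteBox n).mem_nhds (proj_mem hz n))
  have key : ∀ i j : JetCoord, pd i (pd j f) z =
      fderiv ℝ (fderiv ℝ g) (proj n z) (i.dir n) (j.dir n) := fun i j => by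
    rw [pd_eq_of_rep (contDiffOn_fderiv_apply hg (j.dir n))
      (fun z hz => pd_eq_of_rep hg hfg j hz) i hz]
    have hd : DifferentiableAt ℝ (fderiv ℝ g) (proj n z) :=
      (hc.fderiv_right (m := 1) (by norm_cast)).differentiableAt (by simp)
    have hcl := hd.hasFDerivAt.clm_apply (hasFDerivAt_const (j.dir n) (proj n z))
    rw [hcl.fderiv]
    simp
  rw [key, key]
  exact (hc.isSymmSndFDerivAt (by simp; norm_cast)).eq _ _

theorem SmoothLT.pd_u_eq_zero {n : ℕ} {f : JetPoint → ℝ} (h : B.SmoothLT n f) {k : ℕ} (hk : n ≤ k)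
    {z : JetPoint} (hz : z ∈ B.carrier) : pd (.u k) f z = 0 := by
  obtain ⟨g, hg, hfg⟩ := h
  rw [pd_eq_of_rep hg hfg _ hz]
  have : JetCoord.dir n (.u k) = 0 := by
    simp only [JetCoord.dir]
    have : (fun i : Fin n => if (i : ℕ) = k then (1 : ℝ) else 0) = 0 := by
      funext i
      have : (i : ℕ) ≠ k := by omega
      simp [this]
    rw [this]; rfl
  rw [this, map_zero]

theorem SmoothLT.eq_set_of_pd_eq_zero {n : ℕ} {f : JetPoint → ℝ} (h : B.SmoothLT n f)
    {i : JetCoord} (h0 : ∀ z ∈ B.carrier, pd i f z = 0) {z : JetPoint}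
    (hz : z ∈ B.carrier) {a : ℝ} (ha : a ∈ B.range i) : f (z.set i a) = f z := by
  have hd : ∀ s ∈ B.range i, HasDerivAt (fun s => f (z.set i s)) 0 s := fun s hs => by
    have := h.hasDerivAt_set i hz hs
    rwa [h0 _ (set_mem hz hs)] at this
  have := (isOpen_range i).is_const_of_deriv_eq_zero (convex_range i).isPreconnected
    (fun s hs => (hd s hs).differentiableAt.differentiableWithinAt)
    (fun s hs => (hd s hs).deriv) ha (get_mem hz i)
  simpa using this

/-- Because `B.U n` is an interval, u_n may be frozen at any of its points without changing f. -/
theorem SmoothLT.of_pd_u_eq_zero {n : ℕ} {f : JetPoint → ℝ} (h : B.SmoothLT (n + 1) f)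
    (h0 : ∀ z ∈ B.carrier, pd (.u n) f z = 0) : B.SmoothLT n f := by
  obtain ⟨a, ha⟩ := B.nonempty_U n
  obtain ⟨g, hg, hfg⟩ := id h
  refine ⟨fun y => g (y.1, y.2.1, Fin.snoc (α := fun _ => ℝ) y.2.2 a), ?_, fun z hz => ?_⟩
  · refine hg.comp (ContDiff.contDiffOn ?_) ?_
    · refine contDiff_fst.prodMk ((contDiff_fst.comp contDiff_snd).prodMk ?_)
      rw [contDiff_pi]
      intro i
      refine Fin.lastCases ?_ (fun j => ?_) i
      · simpa using contDiff_const
      · simp only [Fin.snoc_castSucc]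
        fun_prop
    · refine fun y hy => ⟨hy.1, hy.2.1, fun i => ?_⟩
      refine Fin.lastCases ?_ (fun j => ?_) i
      · simpa using ha
      · simpa using hy.2.2 j
  · rw [← h.eq_set_of_pd_eq_zero h0 hz ha, hfg _ (set_mem hz ha)]
    congr 1
    simp only [proj, JetPoint.set, Prod.mk.injEq, true_and]
    funext i
    refine Fin.lastCases ?_ (fun j => ?_) i
    · simp
    · simp [j.2.ne]

/-- The integral from a base point a to the i-th coordinate is rescaled to [0, 1]. The limits are
then fixed, and smoothness in all coordinates follows from differentiation under the integral sign.
-/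
theorem SmoothLT.exists_primitive {n : ℕ} {f : JetPoint → ℝ} (h : B.SmoothLT n f) (i : JetCoord)
    (hi : ∀ k, i = .u k → k < n) :
    ∃ G, B.SmoothLT n G ∧ ∀ z ∈ B.carrier, pd i G z = f z := by
  obtain ⟨a, ha⟩ := B.nonempty_range i
  obtain ⟨g, hg, hfg⟩ := id h
  obtain ⟨ℓ, hℓ⟩ : ∃ ℓ : (ℝ × ℝ × (Fin n → ℝ)) →L[ℝ] ℝ, ∀ z, ℓ (proj n z) = z.get i := by
    cases i with
    | t => exact ⟨ContinuousLinearMap.fst ℝ _ _, fun z => rfl⟩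
    | x => exact ⟨(ContinuousLinearMap.fst ℝ _ _).comp (ContinuousLinearMap.snd ℝ _ _),
        fun z => rfl⟩
    | u k => exact ⟨(ContinuousLinearMap.proj (⟨k, hi k rfl⟩ : Fin n)).comp
        ((ContinuousLinearMap.snd ℝ _ _).comp (ContinuousLinearMap.snd ℝ _ _)), fun z => rfl⟩
  set φ : (ℝ × ℝ × (Fin n → ℝ)) × ℝ → ℝ × ℝ × (Fin n → ℝ) :=
    fun w => w.1 + ((w.2 - 1) * (ℓ w.1 - a)) • i.dir n with hφ
  have hφc : ContDiff ℝ ∞ φ := by fun_prop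
  have hφz : ∀ z θ, φ (proj n z, θ) = proj n (z.set i (a + θ * (z.get i - a))) := fun z θ => by
    rw [proj_set, hφ]
    simp only [hℓ]
    congr 2
    ring
  have hmem : ∀ z ∈ B.carrier, ∀ θ ∈ Set.Icc (0 : ℝ) 1,
      z.set i (a + θ * (z.get i - a)) ∈ B.carrier := fun z hz θ hθ =>
    set_mem hz ((convex_range i).add_smul_sub_mem ha (get_mem hz i) hθ)
  have hG1 : ContDiffOn ℝ ∞ (fun y => ∫ θ in (0 : ℝ)..1, g (φ (y, θ))) (B.finiteBox n) := by
    rw [contDiffOn_infty]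
    intro m
    refine contDiffOn_integral_zero_one (W := φ ⁻¹' B.finiteBox n) (f := fun w => g (φ w))
      (isOpen_finiteBox n) ((isOpen_finiteBox n).preimage hφc.continuous) ?_ m
      (hg.comp hφc.contDiffOn fun w hw => hw)
    intro y hy θ hθ
    obtain ⟨z, hz, rfl⟩ := exists_proj_eq hy
    rw [Set.mem_preimage, hφz]
    exact proj_mem (hmem z hz θ hθ) n
  refine ⟨fun z => (ℓ (proj n z) - a) * ∫ θ in (0 : ℝ)..1, g (φ (proj n z, θ)),
    ⟨fun y => (ℓ y - a) * ∫ θ in (0 : ℝ)..1, g (φ (y, θ)), ?_, fun z _ => rfl⟩, fun z hz => ?_⟩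
  · exact (ContDiff.contDiffOn (by fun_prop)).mul hG1
  · have hcont : ContinuousOn (fun s => f (z.set i s)) (B.range i) := fun s hs =>
      (h.hasDerivAt_set i hz hs).continuousAt.continuousWithinAt
    have hftc : HasDerivAt (fun s => ∫ r in a..s, f (z.set i r)) (f (z.set i (z.get i)))
        (z.get i) := by
      have hsub : Set.uIcc a (z.get i) ⊆ B.range i :=
        (B.ordConnected_range i).uIcc_subset ha (get_mem hz i)
      refine intervalIntegral.integral_hasDerivAt_right
        (hcont.mono hsub).intervalIntegrable ?_
        (hcont.continuousAt ((isOpen_range i).mem_nhds (get_mem hz i)))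
      exact hcont.stronglyMeasurableAtFilter (isOpen_range i) _ (get_mem hz i)
    rw [set_get] at hftc
    refine (hftc.congr_of_eventuallyEq ?_).deriv
    filter_upwards [eventually_set_mem hz i] with s hs
    have hsr : s ∈ B.range i := (set_mem_iff hz).1 hs
    have h1 : ∀ θ ∈ Set.uIcc (0 : ℝ) 1, g (φ (proj n (z.set i s), θ)) =
        (fun r => f (z.set i r)) (a + (s - a) * θ) := fun θ hθ => by
      rw [Set.uIcc_of_le zero_le_one] at hθ
      have := hmem _ hs θ hθ
      rw [hφz, ← hfg _ this]
      simp [mul_comm]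
    rw [intervalIntegral.integral_congr h1, hℓ, get_set,
      intervalIntegral.mul_integral_comp_add_mul (f := fun r => f (z.set i r))]
    simp

end JetBox

/-! ### Product, quotient and sum rules for partial derivatives. -/

namespace JetBox

variable {B : JetBox} {n m : ℕ} {f f' : JetPoint → ℝ} {z : JetPoint}

theorem pd_const (i : JetCoord) (c : ℝ) (z : JetPoint) : pd i (fun _ => c) z = 0 := by
  simp [pd]

theorem pd_coord_u_self (k : ℕ) (z : JetPoint) : pd (.u k) (fun z => z.u k) z = 1 := by
  simp [pd, JetPoint.set]

theorem pd_coord_u_of_ne {i : JetCoord} {k : ℕ} (h : i ≠ .u k) (z : JetPoint) :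
    pd i (fun z => z.u k) z = 0 := by
  have : ∀ s, (z.set i s).u k = z.u k := fun s => get_set_of_ne z (i := i) (j := .u k) h.symm s
  simp [pd, this]

theorem pd_add (h : B.SmoothLT n f) (h' : B.SmoothLT m f') (i : JetCoord) (hz : z ∈ B.carrier) :
    pd i (fun z => f z + f' z) z = pd i f z + pd i f' z :=
  ((h.hasDerivAt i hz).add (h'.hasDerivAt i hz)).deriv

theorem pd_sub (h : B.SmoothLT n f) (h' : B.SmoothLT m f') (i : JetCoord) (hz : z ∈ B.carrier) :
    pd i (fun z => f z - f' z) z = pd i f z - pd i f' z :=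
  ((h.hasDerivAt i hz).sub (h'.hasDerivAt i hz)).deriv

theorem pd_neg (i : JetCoord) (f : JetPoint → ℝ) (z : JetPoint) :
    pd i (fun z => - f z) z = - pd i f z := by
  simp [pd]

theorem pd_const_mul (i : JetCoord) (c : ℝ) (f : JetPoint → ℝ) (z : JetPoint) :
    pd i (fun z => c * f z) z = c * pd i f z := by
  simp [pd]

theorem pd_mul (h : B.SmoothLT n f) (h' : B.SmoothLT m f') (i : JetCoord) (hz : z ∈ B.carrier) :
    pd i (fun z => f z * f' z) z = pd i f z * f' z + f z * pd i f' z := by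
  have := ((h.hasDerivAt i hz).fun_mul (h'.hasDerivAt i hz)).deriv
  simp only [set_get] at this
  exact this

theorem pd_div (h : B.SmoothLT n f) (h' : B.SmoothLT m f') (i : JetCoord) (hz : z ∈ B.carrier)
    (h0 : f' z ≠ 0) :
    pd i (fun z => f z / f' z) z = (pd i f z * f' z - f z * pd i f' z) / f' z ^ 2 := by
  have := ((h.hasDerivAt i hz).fun_div (h'.hasDerivAt i hz) (by simpa using h0)).deriv
  simp only [set_get] at this
  exact this

theorem pd_sum {ι : Type} {s : Finset ι} {f : ι → JetPoint → ℝ}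
    (h : ∀ k ∈ s, B.SmoothLT n (f k)) (i : JetCoord) (hz : z ∈ B.carrier) :
    pd i (fun z => ∑ k ∈ s, f k z) z = ∑ k ∈ s, pd i (f k) z :=
  (HasDerivAt.fun_sum fun k hk => (h k hk).hasDerivAt i hz).deriv

end JetBox

/-! ### Total derivatives, their commutators and the counting of orders. -/

namespace JetPoint

/-- The derivation `∂_i + ∑ c_k ∂/∂u_k`. -/
def evol (i : JetCoord) (c : ℕ → JetPoint → ℝ) (f : JetPoint → ℝ) (z : JetPoint) : ℝ :=
  pd i f z + ∑ᶠ k : ℕ, c k z * pd (.u k) f z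

/-- D_x and D_t differ only in the coefficients c_k, so the derivation rules are proved once for
`evol`. -/
theorem totalDx_eq_evol : totalDx = evol .x fun k z => z.u (k + 1) := rfl

theorem totalDt_eq_evol (F : JetPoint → ℝ) : totalDt F = evol .t fun k => totalDx^[k] F := rfl

end JetPoint

namespace JetBox

variable {B : JetBox} {n m : ℕ} {f f' : JetPoint → ℝ} {z : JetPoint}

section Evol

variable {i : JetCoord} {c : ℕ → JetPoint → ℝ}

/-- The free bound N allows functions of different orders to be expanded over the same range. -/
theorem SmoothLT.evol_eq (h : B.SmoothLT n f) {N : ℕ} (hN : n ≤ N) (hz : z ∈ B.carrier) :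
    evol i c f z = pd i f z + ∑ k ∈ Finset.range N, c k z * pd (.u k) f z := by
  rw [evol, finsum_eq_sum_of_support_subset]
  intro k hk
  by_contra hkN
  refine hk ?_
  simp only [Finset.coe_range, Set.mem_Iio, not_lt] at hkN
  simp [h.pd_u_eq_zero (hN.trans hkN) hz]

theorem evol_congr (h : Set.EqOn f f' B.carrier) :
    Set.EqOn (evol i c f) (evol i c f') B.carrier := fun z hz => by
  simp only [evol, pd_congr h _ hz]

theorem evol_add (h : B.SmoothLT n f) (h' : B.SmoothLT m f') (hz : z ∈ B.carrier) :
    evol i c (fun z => f z + f' z) z = evol i c f z + evol i c f' z := by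
  have h1 := h.mono (le_max_left n m)
  have h1' := h'.mono (le_max_right n m)
  rw [(h1.add h1').evol_eq le_rfl hz, h1.evol_eq le_rfl hz, h1'.evol_eq le_rfl hz]
  simp only [pd_add h h' _ hz, mul_add, Finset.sum_add_distrib]
  ring

theorem evol_const (i : JetCoord) (c : ℕ → JetPoint → ℝ) (a : ℝ) (z : JetPoint) :
    evol i c (fun _ => a) z = 0 := by
  simp [evol, pd_const]

theorem evol_mul (h : B.SmoothLT n f) (h' : B.SmoothLT m f') (hz : z ∈ B.carrier) :
    evol i c (fun z => f z * f' z) z = evol i c f z * f' z + f z * evol i c f' z := by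
  have h1 := h.mono (le_max_left n m)
  have h1' := h'.mono (le_max_right n m)
  rw [(h1.mul h1').evol_eq le_rfl hz, h1.evol_eq le_rfl hz, h1'.evol_eq le_rfl hz]
  simp only [pd_mul h h' _ hz, mul_add, add_mul, Finset.sum_add_distrib, Finset.mul_sum,
    Finset.sum_mul]
  have e1 : ∀ k ∈ Finset.range (max n m), c k z * (pd (.u k) f z * f' z) =
    c k z * pd (.u k) f z * f' z := fun _ _ => by ring
  have e2 : ∀ k ∈ Finset.range (max n m), c k z * (f z * pd (.u k) f' z) =
    f z * (c k z * pd (.u k) f' z) := fun _ _ => by ring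
  rw [Finset.sum_congr rfl e1, Finset.sum_congr rfl e2]
  ring

theorem evol_const_mul (h : B.SmoothLT n f) (a : ℝ) (hz : z ∈ B.carrier) :
    evol i c (fun z => a * f z) z = a * evol i c f z := by
  rw [evol_mul (SmoothLT.const n a) h hz, evol_const, zero_mul, zero_add]

theorem evol_sub (h : B.SmoothLT n f) (h' : B.SmoothLT m f') (hz : z ∈ B.carrier) :
    evol i c (fun z => f z - f' z) z = evol i c f z - evol i c f' z := by
  have h1 : B.SmoothLT m fun z => (-1) * f' z := (SmoothLT.const m (-1)).mul h'
  have h2 : (fun z => f z - f' z) = fun z => f z + (-1) * f' z := by funext z; ring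
  rw [h2, evol_add h h1 hz, evol_const_mul h' _ hz]
  ring

theorem evol_sum {ι : Type} {s : Finset ι} {f : ι → JetPoint → ℝ}
    (h : ∀ k ∈ s, B.SmoothLT n (f k)) (hz : z ∈ B.carrier) :
    evol i c (fun z => ∑ k ∈ s, f k z) z = ∑ k ∈ s, evol i c (f k) z := by
  classical
  induction s using Finset.induction_on with
  | empty => simpa using evol_const i c 0 z
  | insert a s ha ih =>
    have h2 : ∀ k ∈ s, B.SmoothLT n (f k) := fun k hk => h k (by simp [hk])
    simp only [Finset.sum_insert ha]
    rw [evol_add (h a (by simp)) (SmoothLT.sum h2) hz, ih h2]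

theorem SmoothLT.smooth_evol (h : B.SmoothLT n f) {N : ℕ} (hN : n ≤ N)
    (hc : ∀ k < n, B.SmoothLT N (c k)) : B.SmoothLT N (evol i c f) := by
  refine SmoothLT.congr (((h.smooth_pd i).mono hN).add (SmoothLT.sum (s := Finset.range n)
    (f := fun k z => c k z * pd (.u k) f z) fun k hk =>
      (hc k (Finset.mem_range.1 hk)).mul ((h.smooth_pd _).mono hN))) ?_
  exact fun z hz => h.evol_eq le_rfl hz

end Evol

section Total

variable {F : JetPoint → ℝ}

theorem SmoothLT.totalDx_eq (h : B.SmoothLT n f) {N : ℕ} (hN : n ≤ N) (hz : z ∈ B.carrier) :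
    totalDx f z = pd .x f z + ∑ k ∈ Finset.range N, z.u (k + 1) * pd (.u k) f z :=
  h.evol_eq (i := .x) (c := fun k z => z.u (k + 1)) hN hz

theorem SmoothLT.totalDt_eq (h : B.SmoothLT n f) {N : ℕ} (hN : n ≤ N) (hz : z ∈ B.carrier) :
    totalDt F f z = pd .t f z + ∑ k ∈ Finset.range N, (totalDx^[k] F) z * pd (.u k) f z :=
  h.evol_eq (i := .t) (c := fun k => totalDx^[k] F) hN hz

theorem totalDx_congr (h : Set.EqOn f f' B.carrier) :
    Set.EqOn (totalDx f) (totalDx f') B.carrier :=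
  evol_congr (i := .x) (c := fun k z => z.u (k + 1)) h

theorem totalDt_congr (h : Set.EqOn f f' B.carrier) :
    Set.EqOn (totalDt F f) (totalDt F f') B.carrier :=
  evol_congr (i := .t) (c := fun k => totalDx^[k] F) h

theorem totalDx_add (h : B.SmoothLT n f) (h' : B.SmoothLT m f') (hz : z ∈ B.carrier) :
    totalDx (fun z => f z + f' z) z = totalDx f z + totalDx f' z :=
  evol_add (i := .x) (c := fun k z => z.u (k + 1)) h h' hz

theorem totalDt_add (h : B.SmoothLT n f) (h' : B.SmoothLT m f') (hz : z ∈ B.carrier) :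
    totalDt F (fun z => f z + f' z) z = totalDt F f z + totalDt F f' z :=
  evol_add (i := .t) (c := fun k => totalDx^[k] F) h h' hz

theorem totalDx_sub (h : B.SmoothLT n f) (h' : B.SmoothLT m f') (hz : z ∈ B.carrier) :
    totalDx (fun z => f z - f' z) z = totalDx f z - totalDx f' z :=
  evol_sub (i := .x) (c := fun k z => z.u (k + 1)) h h' hz

theorem totalDt_sub (h : B.SmoothLT n f) (h' : B.SmoothLT m f') (hz : z ∈ B.carrier) :
    totalDt F (fun z => f z - f' z) z = totalDt F f z - totalDt F f' z :=
  evol_sub (i := .t) (c := fun k => totalDx^[k] F) h h' hz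

theorem totalDx_const_mul (h : B.SmoothLT n f) (a : ℝ) (hz : z ∈ B.carrier) :
    totalDx (fun z => a * f z) z = a * totalDx f z :=
  evol_const_mul (i := .x) (c := fun k z => z.u (k + 1)) h a hz

theorem totalDt_const_mul (h : B.SmoothLT n f) (a : ℝ) (hz : z ∈ B.carrier) :
    totalDt F (fun z => a * f z) z = a * totalDt F f z :=
  evol_const_mul (i := .t) (c := fun k => totalDx^[k] F) h a hz

theorem totalDx_mul (h : B.SmoothLT n f) (h' : B.SmoothLT m f') (hz : z ∈ B.carrier) :
    totalDx (fun z => f z * f' z) z = totalDx f z * f' z + f z * totalDx f' z :=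
  evol_mul (i := .x) (c := fun k z => z.u (k + 1)) h h' hz

theorem totalDx_sum {ι : Type} {s : Finset ι} {f : ι → JetPoint → ℝ}
    (h : ∀ k ∈ s, B.SmoothLT n (f k)) (hz : z ∈ B.carrier) :
    totalDx (fun z => ∑ k ∈ s, f k z) z = ∑ k ∈ s, totalDx (f k) z :=
  evol_sum (i := .x) (c := fun k z => z.u (k + 1)) h hz

end Total

theorem SmoothLT.smooth_totalDx (h : B.SmoothLT n f) : B.SmoothLT (n + 1) (totalDx f) :=
  h.smooth_evol (i := .x) (c := fun k z => z.u (k + 1)) (Nat.le_succ n) fun k hk => SmoothLT.coord_u (k := k + 1) (by omega)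

theorem SmoothLT.iterate_totalDx (h : B.SmoothLT n f) (k : ℕ) :
    B.SmoothLT (n + k) (totalDx^[k] f) := by
  induction k with
  | zero => exact h
  | succ k ih =>
    rw [Function.iterate_succ_apply']
    exact ih.smooth_totalDx

theorem SmoothLT.smooth_totalDt {F : JetPoint → ℝ} (hF : B.SmoothLT m F) (h : B.SmoothLT n f) :
    B.SmoothLT (m + n) (totalDt F f) :=
  h.smooth_evol (i := .t) (c := fun k => totalDx^[k] F) (Nat.le_add_left n m) fun k hk => (hF.iterate_totalDx k).mono (by omega)

theorem pd_totalDx (h : B.SmoothLT n f) (i : JetCoord) {N : ℕ} (hN : n ≤ N) (hz : z ∈ B.carrier) :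
    pd i (totalDx f) z = totalDx (pd i f) z +
      ∑ k ∈ Finset.range N, pd i (fun z => z.u (k + 1)) z * pd (.u k) f z := by
  have hu : ∀ k ∈ Finset.range N, B.SmoothLT (N + 1) fun z => z.u (k + 1) := fun k hk =>
    SmoothLT.coord_u (by simpa using hk)
  have h' := h.mono (hN.trans (Nat.le_succ N))
  have h1 : Set.EqOn (totalDx f) (fun z => pd .x f z +
      ∑ k ∈ Finset.range N, z.u (k + 1) * pd (.u k) f z) B.carrier := fun z hz => h.totalDx_eq hN hz
  have h2 : ∀ k ∈ Finset.range N, B.SmoothLT (N + 1) fun z => z.u (k + 1) * pd (.u k) f z :=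
    fun k hk => (hu k hk).mul (h'.smooth_pd _)
  rw [pd_congr h1 i hz, pd_add (h.smooth_pd _) (SmoothLT.sum h2) i hz, pd_sum h2 i hz,
    (h.smooth_pd i).totalDx_eq hN hz, h.pd_comm i .x hz, add_assoc,
    ← Finset.sum_add_distrib]
  congr 1
  refine Finset.sum_congr rfl fun k hk => ?_
  rw [pd_mul (hu k hk) (h.smooth_pd _) i hz, h.pd_comm i _ hz]
  ring

/-- The commutator of ∂/∂u_{k+1} with D_x is ∂/∂u_k, since u_{k+1} is the coefficient of ∂/∂u_k in
D_x. All order counts below rest on this. -/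
theorem pd_u_succ_totalDx (h : B.SmoothLT n f) (k : ℕ) (hz : z ∈ B.carrier) :
    pd (.u (k + 1)) (totalDx f) z =
      totalDx (pd (.u (k + 1)) f) z + pd (.u k) f z := by
  rw [pd_totalDx h _ (le_max_left n (k + 1)) hz,
    Finset.sum_eq_single_of_mem k (by simp) fun j _ hj => ?_, pd_coord_u_self, one_mul]
  rw [pd_coord_u_of_ne (by simpa using hj.symm), zero_mul]

theorem pd_totalDx_of_ne (h : B.SmoothLT n f) {i : JetCoord} (hi : ∀ k, i ≠ .u (k + 1))
    (hz : z ∈ B.carrier) : pd i (totalDx f) z = totalDx (pd i f) z := by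
  rw [pd_totalDx h _ le_rfl hz, Finset.sum_eq_zero fun j _ => ?_, add_zero]
  rw [pd_coord_u_of_ne (hi j), zero_mul]

theorem totalDx_zero_of_eqOn (h : ∀ z ∈ B.carrier, f z = 0) (hz : z ∈ B.carrier) :
    totalDx f z = 0 := by
  rw [totalDx_eq_evol, evol_congr (f' := fun _ => 0) h hz, evol_const]

/-- Differentiating the coefficient D_x^k F shifts it to D_x^{k+1} F; the commutator of ∂/∂u_{k+1}
with D_x produces the same terms on the other side. -/
theorem totalDx_totalDt_comm {F : JetPoint → ℝ} (hF : B.SmoothLT m F) (h : B.SmoothLT n f)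
    (hz : z ∈ B.carrier) :
    totalDx (totalDt F f) z = totalDt F (totalDx f) z := by
  have hs : ∀ k ∈ Finset.range n,
      B.SmoothLT (m + n) fun z => (totalDx^[k] F) z * pd (.u k) f z := fun k hk =>
    ((hF.iterate_totalDx k).mono (by have := Finset.mem_range.1 hk; omega)).mul
      ((h.smooth_pd _).mono (by omega))
  have h1 : Set.EqOn (totalDt F f) (fun z => pd .t f z +
      ∑ k ∈ Finset.range n, (totalDx^[k] F) z * pd (.u k) f z) B.carrier :=
    fun z hz => h.totalDt_eq le_rfl hz
  have h0 : totalDx (totalDt F f) z = totalDx (pd .t f) z + ∑ k ∈ Finset.range n,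
      totalDx (fun z => (totalDx^[k] F) z * pd (.u k) f z) z := by
    rw [totalDx_congr h1 hz, totalDx_add (h.smooth_pd _) (SmoothLT.sum hs) hz, totalDx_sum hs hz]
  rw [h0, h.smooth_totalDx.totalDt_eq le_rfl hz,
    pd_totalDx_of_ne h (i := .t) (by simp) hz]
  congr 1
  have h2 : ∀ k ∈ Finset.range n,
      totalDx (fun z => (totalDx^[k] F) z * pd (.u k) f z) z =
        (totalDx^[k + 1] F) z * pd (.u k) f z +
          (totalDx^[k] F) z * totalDx (pd (.u k) f) z := fun k _ => by
    rw [totalDx_mul (hF.iterate_totalDx k) (h.smooth_pd _) hz,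
      Function.iterate_succ_apply']
  rw [Finset.sum_congr rfl h2, Finset.sum_add_distrib, Finset.sum_range_succ']
  have h3 : ∀ k ∈ Finset.range n,
      (totalDx^[k + 1] F) z * pd (.u (k + 1)) (totalDx f) z =
        (totalDx^[k + 1] F) z * totalDx (pd (.u (k + 1)) f) z +
          (totalDx^[k + 1] F) z * pd (.u k) f z := fun k _ => by
    rw [pd_u_succ_totalDx h k hz]; ring
  rw [Finset.sum_congr rfl h3, Finset.sum_add_distrib,
    pd_totalDx_of_ne h (i := .u 0) (by simp) hz]
  -- Shifting the index by one adds only the term k = n, which vanishes because f does not involve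
  -- u_n.
  have h4 : ∑ k ∈ Finset.range n, (totalDx^[k] F) z * totalDx (pd (.u k) f) z =
      ∑ k ∈ Finset.range n,
        (totalDx^[k + 1] F) z * totalDx (pd (.u (k + 1)) f) z +
        (totalDx^[0] F) z * totalDx (pd (.u 0) f) z := by
    rw [← Finset.sum_range_succ' (fun k =>
      (totalDx^[k] F) z * totalDx (pd (.u k) f) z), Finset.sum_range_succ,
      totalDx_zero_of_eqOn (fun z hz => h.pd_u_eq_zero le_rfl hz) hz, mul_zero, add_zero]
  rw [h4]
  ring

/-- A function whose total derivative has order `< n + 1` has itself order `< n`. -/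
theorem SmoothLT.of_totalDx (h : B.SmoothLT m f) (h' : B.SmoothLT (n + 1) (totalDx f)) :
    B.SmoothLT n f := by
  induction m with
  | zero => exact h.mono (Nat.zero_le _)
  | succ m ih =>
    by_cases hnm : n ≤ m
    · refine ih (h.of_pd_u_eq_zero fun z hz => ?_)
      -- The coefficient of u_{m+1} in D_x f is the derivative of f in u_m; the bound on the order
      -- of D_x f makes it zero.
      have h1 := pd_u_succ_totalDx h m hz
      rw [h'.pd_u_eq_zero (by omega) hz,
        totalDx_zero_of_eqOn (fun z hz => h.pd_u_eq_zero le_rfl hz) hz, zero_add] at h1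
      exact h1.symm
    · exact h.mono (by omega)

theorem SmoothLT.totalDx_eq_pd (h : B.SmoothLT 0 f) (hz : z ∈ B.carrier) :
    totalDx f z = pd .x f z := by
  rw [h.totalDx_eq le_rfl hz]; simp

end JetBox

/-! ### Conservation laws modulo trivial ones, and reduction of the order of densities. -/

namespace JetBox

variable {B : JetBox} {n m : ℕ} {F f f' ρ σ ρ' σ' : JetPoint → ℝ} {z : JetPoint}

theorem IsConservationLaw.sub (h : B.IsConservationLaw F ρ σ) (h' : B.IsConservationLaw F ρ' σ') :
    B.IsConservationLaw F (fun z => ρ z - ρ' z) (fun z => σ z - σ' z) := by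
  obtain ⟨⟨n, hρ⟩, ⟨m, hσ⟩, hl⟩ := h
  obtain ⟨⟨n', hρ'⟩, ⟨m', hσ'⟩, hl'⟩ := h'
  replace hρ : B.SmoothLT n ρ := hρ
  replace hσ : B.SmoothLT m σ := hσ
  replace hρ' : B.SmoothLT n' ρ' := hρ'
  replace hσ' : B.SmoothLT m' σ' := hσ'
  refine ⟨⟨max n n', (hρ.mono (le_max_left _ _)).sub (hρ'.mono (le_max_right _ _))⟩,
    ⟨max m m', (hσ.mono (le_max_left _ _)).sub (hσ'.mono (le_max_right _ _))⟩, fun z hz => ?_⟩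
  rw [totalDt_sub hρ hρ' hz, totalDx_sub hσ hσ' hz, hl z hz, hl' z hz]

theorem IsConservationLaw.const_mul (h : B.IsConservationLaw F ρ σ) (c : ℝ) :
    B.IsConservationLaw F (fun z => c * ρ z) (fun z => c * σ z) := by
  obtain ⟨⟨n, hρ⟩, ⟨m, hσ⟩, hl⟩ := h
  replace hρ : B.SmoothLT n ρ := hρ
  replace hσ : B.SmoothLT m σ := hσ
  refine ⟨⟨n, (SmoothLT.const n c).mul hρ⟩, ⟨m, (SmoothLT.const m c).mul hσ⟩, fun z hz => ?_⟩
  rw [totalDt_const_mul hρ c hz, totalDx_const_mul hσ c hz, hl z hz]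

theorem SmoothLT.isConservationLaw (hF : B.SmoothLT m F) (hf : B.SmoothLT n f) :
    B.IsConservationLaw F (totalDx f) (totalDt F f) :=
  ⟨⟨_, hf.smooth_totalDx⟩, ⟨_, hF.smooth_totalDt hf⟩, fun _ hz =>
    (totalDx_totalDt_comm hF hf hz).symm⟩

theorem IsConservationLaw.sub_totalDx (hF : B.SmoothLT m F) (h : B.IsConservationLaw F ρ σ)
    (hf : B.SmoothLT n f) :
    B.IsConservationLaw F (fun z => ρ z - totalDx f z) (fun z => σ z - totalDt F f z) :=
  h.sub (hF.isConservationLaw hf)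

theorem SmoothLT.set_x (h : B.SmoothLT n f) {a : ℝ} (ha : a ∈ B.J) :
    B.SmoothLT n fun z => f (z.set .x a) := by
  obtain ⟨g, hg, hfg⟩ := h
  refine ⟨fun y => g (y.1, a, y.2.2), ?_, fun z hz => hfg _ (set_mem hz ha)⟩
  exact hg.comp (ContDiff.contDiffOn (by fun_prop)) fun y hy => ⟨hy.1, ha, hy.2.2⟩

/-- A flux with vanishing total `x`-derivative is the `t`-derivative of a function of `t`. -/
theorem SmoothLT.exists_of_totalDx_eq_zero (h : B.SmoothLT n f)
    (h0 : ∀ z ∈ B.carrier, totalDx f z = 0) :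
    ∃ S, B.SmoothLT 0 S ∧ ∀ z ∈ B.carrier, totalDx S z = 0 ∧ totalDt F S z = f z := by
  have hf : B.SmoothLT 0 f := h.of_totalDx ((SmoothLT.const 1 0).congr h0)
  have hfx : ∀ z ∈ B.carrier, pd .x f z = 0 := fun z hz => by
    rw [← hf.totalDx_eq_pd hz, h0 z hz]
  -- A t-primitive may still depend on x; fixing x = a removes this, and f itself is free of x.
  obtain ⟨G, hG, hGf⟩ := hf.exists_primitive .t (by simp)
  obtain ⟨a, ha⟩ := B.nonempty_J
  have hS := hG.set_x ha
  refine ⟨fun z => G (z.set .x a), hS, fun z hz => ⟨?_, ?_⟩⟩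
  · rw [hS.totalDx_eq_pd hz]
    simp [pd]
  · rw [hS.totalDt_eq le_rfl hz]
    have h1 : pd .t (fun z => G (z.set .x a)) z = pd .t G (z.set .x a) := rfl
    rw [h1, hGf _ (set_mem hz ha), hf.eq_set_of_pd_eq_zero hfx hz ha]
    simp

/-- Only the density decides triviality: σ - D_t f has zero total x-derivative, hence depends on t
alone, and its t-primitive can be added to f. -/
theorem IsConservationLaw.isTrivialLaw (hF : B.SmoothLT m F) (h : B.IsConservationLaw F ρ σ)
    (hf : B.SmoothLT n f) (hρ : ∀ z ∈ B.carrier, ρ z = totalDx f z) : B.IsTrivialLaw F ρ σ := by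
  obtain ⟨-, ⟨k, hτ⟩, hl⟩ := h.sub_totalDx hF hf
  have h0 : ∀ z ∈ B.carrier, totalDx (fun z => σ z - totalDt F f z) z = 0 := fun z hz => by
    have h1 : Set.EqOn (fun z => ρ z - totalDx f z) (fun _ => 0) B.carrier := fun z hz => by
      simp [hρ z hz]
    rw [← hl z hz, totalDt_congr h1 hz, totalDt_eq_evol, evol_const]
  obtain ⟨S, hS, hS'⟩ := SmoothLT.exists_of_totalDx_eq_zero (F := F) (n := k) hτ h0
  refine ⟨fun z => f z + S z, ⟨n, hf.add (hS.mono (Nat.zero_le n))⟩, fun z hz => ?_⟩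
  rw [totalDx_add hf hS hz, totalDt_add hf hS hz, (hS' z hz).1, (hS' z hz).2, hρ z hz]
  simp

theorem IsTrivialLaw.sub (h : B.IsTrivialLaw F ρ σ) (h' : B.IsTrivialLaw F ρ' σ') :
    B.IsTrivialLaw F (fun z => ρ z - ρ' z) (fun z => σ z - σ' z) := by
  obtain ⟨f, ⟨n, hf⟩, hl⟩ := h
  obtain ⟨f', ⟨n', hf'⟩, hl'⟩ := h'
  replace hf : B.SmoothLT n f := hf
  replace hf' : B.SmoothLT n' f' := hf'
  refine ⟨fun z => f z - f' z,
    ⟨max n n', (hf.mono (le_max_left _ _)).sub (hf'.mono (le_max_right _ _))⟩, fun z hz => ?_⟩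
  beta_reduce
  rw [totalDx_sub hf hf' hz, totalDt_sub hf hf' hz, (hl z hz).1, (hl z hz).2, (hl' z hz).1,
    (hl' z hz).2]
  exact ⟨rfl, rfl⟩

theorem IsTrivialLaw.congr (h : B.IsTrivialLaw F ρ σ) (hρ : Set.EqOn ρ' ρ B.carrier)
    (hσ : Set.EqOn σ' σ B.carrier) : B.IsTrivialLaw F ρ' σ' := by
  obtain ⟨f, hf, hl⟩ := h
  exact ⟨f, hf, fun z hz => by rw [hρ hz, hσ hz]; exact hl z hz⟩

section OrderReduction

/-- Each D_x raises the order by one and keeps the leading coefficient. -/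
theorem pd_u_iterate_totalDx (hF : B.SmoothLT 3 F) (k : ℕ) (hz : z ∈ B.carrier) :
    pd (.u (k + 2)) (totalDx^[k] F) z = pd (.u 2) F z := by
  induction k generalizing z with
  | zero => rfl
  | succ k ih =>
    have hk := hF.iterate_totalDx k
    rw [Function.iterate_succ_apply', show k + 1 + 2 = (k + 2) + 1 by ring,
      pd_u_succ_totalDx hk _ hz, ih hz,
      totalDx_zero_of_eqOn (fun z hz => hk.pd_u_eq_zero (by omega) hz) hz, zero_add]

/-- A density of order `k + 1 ≥ 1` of an evolution equation of order two whose right-hand side is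
affine in `u_xx` is affine in its highest derivative. -/
theorem IsConservationLaw.pd_pd_density_eq_zero (hF : B.SmoothLT 3 F)
    (ha : B.SmoothLT 2 (pd (.u 2) F)) (ha0 : ∀ z ∈ B.carrier, pd (.u 2) F z ≠ 0)
    (h : B.IsConservationLaw F ρ σ) {k : ℕ} (hρ : B.SmoothLT (k + 2) ρ) (hz : z ∈ B.carrier) :
    pd (.u (k + 1)) (pd (.u (k + 1)) ρ) z = 0 := by
  obtain ⟨-, ⟨m, hσ⟩, hl⟩ := h
  replace hσ : B.SmoothLT m σ := hσ
  set ρK := pd (.u (k + 1)) ρ with hρK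
  have hρKs : B.SmoothLT (k + 2) ρK := hρ.smooth_pd _
  set E := totalDx^[k] F with hE
  have hEs : B.SmoothLT (k + 3) E := by
    have := hF.iterate_totalDx k
    rwa [Nat.add_comm] at this
  set D := totalDx ρK with hD
  have hDs : B.SmoothLT (k + 3) D := hρKs.smooth_totalDx
  -- Subtracting ρ_K D_x^k F, with K = k + 1, cancels the term ρ_K D_x^{k+1} F of D_tρ. Then D_xτ
  -- involves nothing beyond u_{k+2}, so τ involves nothing beyond u_{k+1}, and D_xτ is affine in
  -- u_{k+2}.
  set τ : JetPoint → ℝ := fun z => σ z - ρK z * E z with hτ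
  have hτs : B.SmoothLT (max m (k + 3)) τ :=
    (hσ.mono (le_max_left _ _)).sub
      (((hρKs.mono (by omega)).mul hEs).mono (le_max_right _ _))
  set P : JetPoint → ℝ := fun z => pd .t ρ z + ∑ j ∈ Finset.range (k + 1),
    (totalDx^[j] F) z * pd (.u j) ρ z with hP
  have hterm : ∀ j ∈ Finset.range (k + 1),
      B.SmoothLT (k + 3) fun z => (totalDx^[j] F) z * pd (.u j) ρ z := fun j hj =>
    ((hF.iterate_totalDx j).mono (by have := Finset.mem_range.1 hj; omega)).mul
      ((hρ.smooth_pd _).mono (by omega))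
  have hPs : B.SmoothLT (k + 3) P :=
    ((hρ.smooth_pd _).mono (by omega)).add (SmoothLT.sum hterm)
  have hR : Set.EqOn (totalDx τ) (fun z => P z - D z * E z) B.carrier := fun z hz => by
    rw [totalDx_sub hσ ((hρKs.mono (Nat.le_succ _)).mul hEs) hz, totalDx_mul hρKs hEs hz,
      ← hl z hz, hρ.totalDt_eq le_rfl hz, Finset.sum_range_succ]
    simp only [hP, hE, ← hρK, ← hD, Function.iterate_succ_apply']
    ring
  have hτs' : B.SmoothLT (k + 2) τ := hτs.of_totalDx ((hPs.sub (hDs.mul hEs)).congr hR)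
  have hτ1 : Set.EqOn (pd (.u (k + 2)) (totalDx τ)) (pd (.u (k + 1)) τ) B.carrier := fun z hz => by
    rw [pd_u_succ_totalDx hτs' (k + 1) hz,
      totalDx_zero_of_eqOn (fun z hz => hτs'.pd_u_eq_zero le_rfl hz) hz, zero_add]
  have hτ2 : pd (.u (k + 2)) (pd (.u (k + 2)) (totalDx τ)) z = 0 := by
    rw [pd_congr hτ1 _ hz]
    exact (hτs'.smooth_pd _).pd_u_eq_zero le_rfl hz
  have hP1 : Set.EqOn (pd (.u (k + 2)) P) (fun z => pd (.u 2) F z * pd (.u k) ρ z) B.carrier :=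
    fun z hz => by
    rw [hP, pd_add (hρ.smooth_pd _) (SmoothLT.sum hterm) _ hz, pd_sum hterm _ hz,
      (hρ.smooth_pd _).pd_u_eq_zero le_rfl hz, zero_add,
      Finset.sum_eq_single_of_mem k (by simp) fun j hj hjk => ?_,
      pd_mul (hF.iterate_totalDx k) (hρ.smooth_pd _) _ hz, pd_u_iterate_totalDx hF k hz,
      (hρ.smooth_pd _).pd_u_eq_zero le_rfl hz, mul_zero, add_zero]
    have hj' := Finset.mem_range.1 hj
    rw [pd_mul (hF.iterate_totalDx j) (hρ.smooth_pd _) _ hz,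
      (hF.iterate_totalDx j).pd_u_eq_zero (by omega) hz,
      (hρ.smooth_pd _).pd_u_eq_zero le_rfl hz, mul_zero, zero_mul, zero_add]
  have hD1 : Set.EqOn (pd (.u (k + 2)) D) (pd (.u (k + 1)) ρK) B.carrier := fun z hz => by
    rw [hD, pd_u_succ_totalDx hρKs (k + 1) hz,
      totalDx_zero_of_eqOn (fun z hz => hρKs.pd_u_eq_zero le_rfl hz) hz, zero_add]
  have hE1 : Set.EqOn (pd (.u (k + 2)) E) (pd (.u 2) F) B.carrier := fun z hz =>
    pd_u_iterate_totalDx hF k hz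
  have hQ1 : Set.EqOn (pd (.u (k + 2)) fun z => P z - D z * E z) (fun z =>
      pd (.u 2) F z * pd (.u k) ρ z - (pd (.u (k + 1)) ρK z * E z + D z * pd (.u 2) F z))
      B.carrier := fun z hz => by
    rw [pd_sub hPs (hDs.mul hEs) _ hz, pd_mul hDs hEs _ hz, hP1 hz, hD1 hz, hE1 hz]
  rw [pd_congr hR _ |>.trans hQ1 |> fun h => pd_congr h _ hz] at hτ2
  have ha' := ha.mono (show 2 ≤ k + 3 by omega)
  -- P, D and E are each affine in u_{k+2}, with D and E having coefficients ρ_KK and a = F_{u_2}.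
  -- The second derivative of P - D E is thus -2 a ρ_KK, which must vanish.
  have hρKK : B.SmoothLT (k + 3) (pd (.u (k + 1)) ρK) := (hρKs.smooth_pd _).mono (by omega)
  have hρk : B.SmoothLT (k + 3) (pd (.u k) ρ) := (hρ.smooth_pd _).mono (by omega)
  rw [pd_sub (ha'.mul hρk) ((hρKK.mul hEs).add (hDs.mul ha')) _ hz,
    pd_add (hρKK.mul hEs) (hDs.mul ha') _ hz, pd_mul ha' hρk _ hz, pd_mul hρKK hEs _ hz,
    pd_mul hDs ha' _ hz, hD1 hz, hE1 hz, ha.pd_u_eq_zero (by omega) hz,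
    (hρKs.smooth_pd _).pd_u_eq_zero le_rfl hz, (hρ.smooth_pd _).pd_u_eq_zero le_rfl hz] at hτ2
  have : pd (.u (k + 1)) ρK z * pd (.u 2) F z = 0 := by linarith
  exact (mul_eq_zero.1 this).resolve_right (ha0 z hz)

/-- The density is affine in u_{k+1}. If G is a primitive in u_k of its leading coefficient, D_xG
has the same leading coefficient, and the difference loses u_{k+1}. -/
theorem IsConservationLaw.exists_sub_totalDx_order_lt (hF : B.SmoothLT 3 F)
    (ha : B.SmoothLT 2 (pd (.u 2) F)) (ha0 : ∀ z ∈ B.carrier, pd (.u 2) F z ≠ 0)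
    (h : B.IsConservationLaw F ρ σ) {k : ℕ} (hρ : B.SmoothLT (k + 2) ρ) :
    ∃ G, B.SmoothLT (k + 1) G ∧ B.SmoothLT (k + 1) fun z => ρ z - totalDx G z := by
  have hK : B.SmoothLT (k + 1) (pd (.u (k + 1)) ρ) := (hρ.smooth_pd _).of_pd_u_eq_zero
    fun z hz => h.pd_pd_density_eq_zero hF ha ha0 hρ hz
  obtain ⟨G, hG, hGρ⟩ := hK.exists_primitive (.u k) (by simp)
  refine ⟨G, hG, (hρ.sub hG.smooth_totalDx).of_pd_u_eq_zero fun z hz => ?_⟩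
  rw [pd_sub hρ hG.smooth_totalDx _ hz, pd_u_succ_totalDx hG k hz, hGρ z hz,
    totalDx_zero_of_eqOn (fun z hz => hG.pd_u_eq_zero le_rfl hz) hz]
  ring

theorem IsConservationLaw.exists_sub_totalDx_order_zero (hF : B.SmoothLT 3 F)
    (ha : B.SmoothLT 2 (pd (.u 2) F)) (ha0 : ∀ z ∈ B.carrier, pd (.u 2) F z ≠ 0)
    (h : B.IsConservationLaw F ρ σ) :
    ∃ n G, B.SmoothLT n G ∧ B.SmoothLT 1 fun z => ρ z - totalDx G z := by
  obtain ⟨k, hρ⟩ : ∃ k, B.SmoothLT (k + 1) ρ := by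
    obtain ⟨n, hρ⟩ := h.density
    exact ⟨n, SmoothLT.mono (n := n) hρ (Nat.le_succ n)⟩
  induction k generalizing ρ σ with
  | zero =>
    refine ⟨0, fun _ => 0, SmoothLT.const 0 0, hρ.congr fun z _ => ?_⟩
    simp [totalDx_eq_evol, evol_const]
  | succ k ih =>
    obtain ⟨G, hG, hG'⟩ := h.exists_sub_totalDx_order_lt hF ha ha0 hρ
    obtain ⟨n, G', hn, hρ'⟩ := ih (h.sub_totalDx hF hG) hG'
    have h1 := hG.mono (le_max_left (k + 1) n)
    have h2 := hn.mono (le_max_right (k + 1) n)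
    refine ⟨_, fun z => G z + G' z, h1.add h2, hρ'.congr fun z hz => ?_⟩
    simp only
    rw [totalDx_add h1 h2 hz]
    ring

end OrderReduction

end JetBox

/-! ### Coefficient comparison and the functions 1/u. -/

namespace JetBox

variable {B : JetBox} {n m : ℕ} {F f f' ρ σ : JetPoint → ℝ} {z : JetPoint}

/-- The coefficients do not involve u_k, so the identity may be evaluated at the three values u_k
and u_k ± ε/2 within the interval. -/
theorem SmoothLT.quadratic_coeff_eq_zero {k : ℕ} {a b c : JetPoint → ℝ} (ha : B.SmoothLT k a)
    (hb : B.SmoothLT k b) (hc : B.SmoothLT k c)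
    (h : ∀ z ∈ B.carrier, a z + b z * z.u k + c z * z.u k ^ 2 = 0) (hz : z ∈ B.carrier) :
    a z = 0 ∧ b z = 0 ∧ c z = 0 := by
  have key : ∀ {f : JetPoint → ℝ}, B.SmoothLT k f → ∀ s ∈ B.U k, f (z.set (.u k) s) = f z :=
    fun hf s hs => (hf.mono (Nat.le_succ k)).eq_set_of_pd_eq_zero
      (fun z hz => hf.pd_u_eq_zero le_rfl hz) hz hs
  obtain ⟨ε, hε, hball⟩ := Metric.isOpen_iff.1 (B.isOpen_U k) _ (hz.2.2 k)
  have h1 : ∀ d, |d| < ε → a z + b z * (z.u k + d) + c z * (z.u k + d) ^ 2 = 0 := fun d hd => by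
    have hm : z.u k + d ∈ B.U k := hball (by simpa [Real.dist_eq] using hd)
    have := h _ (set_mem hz (i := .u k) hm)
    rw [key ha _ hm, key hb _ hm, key hc _ hm] at this
    simpa [JetPoint.set] using this
  have e0 := h1 0 (by simpa using hε)
  have hd : |ε / 2| < ε := by rw [abs_of_pos (by linarith)]; linarith
  have e1 := h1 (ε / 2) hd
  have e2 := h1 (-(ε / 2)) (by rwa [abs_neg])
  have hc0 : c z * ε ^ 2 = 0 := by linear_combination 2 * e1 + 2 * e2 - 4 * e0
  have hc1 : c z = 0 := (mul_eq_zero.1 hc0).resolve_right (by positivity)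
  have hb0 : b z * ε = 0 := by
    rw [hc1] at e1 e2; linear_combination e1 - e2
  have hb1 : b z = 0 := (mul_eq_zero.1 hb0).resolve_right hε.ne'
  refine ⟨?_, hb1, hc1⟩
  rw [hb1, hc1] at e0
  linarith

theorem totalDx_coord_u (k : ℕ) (hz : z ∈ B.carrier) : totalDx (fun z => z.u k) z = z.u (k + 1) := by
  rw [(SmoothLT.coord_u (B := B) (Nat.lt_succ_self k)).totalDx_eq le_rfl hz,
    pd_coord_u_of_ne (by simp), Finset.sum_eq_single_of_mem k (by simp) fun j _ hj => ?_,
    pd_coord_u_self]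
  · simp
  · rw [pd_coord_u_of_ne (by simpa using hj), mul_zero]

section Inv

variable (hB : (0 : ℝ) ∉ B.U 0)
include hB

theorem u_zero_ne_zero (hz : z ∈ B.carrier) : z.u 0 ≠ 0 := fun h => hB (h ▸ hz.2.2 0)

theorem smoothLT_inv_u : B.SmoothLT 1 fun z => 1 / z.u 0 :=
  (SmoothLT.const 1 1).div (SmoothLT.coord_u one_pos) fun _ hz => u_zero_ne_zero hB hz

theorem pd_u_inv_u (hz : z ∈ B.carrier) : pd (.u 0) (fun z => 1 / z.u 0) z = -1 / z.u 0 ^ 2 := by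
  rw [pd_div (SmoothLT.const 1 1) (SmoothLT.coord_u one_pos) _ hz (u_zero_ne_zero hB hz),
    pd_const, pd_coord_u_self]
  ring

theorem pd_inv_u_of_ne {i : JetCoord} (hi : i ≠ .u 0) (hz : z ∈ B.carrier) :
    pd i (fun z => 1 / z.u 0) z = 0 := by
  rw [pd_div (SmoothLT.const 1 1) (SmoothLT.coord_u one_pos) _ hz (u_zero_ne_zero hB hz),
    pd_const, pd_coord_u_of_ne hi]
  ring

theorem totalDx_inv_u (hz : z ∈ B.carrier) :
    totalDx (fun z => 1 / z.u 0) z = - z.u 1 / z.u 0 ^ 2 := by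
  rw [(smoothLT_inv_u hB).totalDx_eq le_rfl hz, pd_inv_u_of_ne hB (by simp) hz]
  simp only [Finset.sum_range_one, pd_u_inv_u hB hz]
  ring

end Inv

end JetBox

/-! ### Densities of order zero: the determining equations and their solution. -/

/-- The right-hand side of the equation with the parameter given as a function on the jet space. -/
def jetRHS (b : JetPoint → ℝ) (z : JetPoint) : ℝ :=
  (pd .x b z * z.u 0 ^ 2) * z.u 2
    + ((2 * pd .x (pd .x b) z * z.u 0 ^ 2 + 4 * b z) * z.u 1
      + ((pd .x (pd .x (pd .x b)) z - 4 * pd .x b z) * z.u 0 ^ 3 - 4 * pd .x b z * z.u 0))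

namespace JetBox

variable {B : JetBox} {n m : ℕ} {b h ρ σ : JetPoint → ℝ} {z : JetPoint}

theorem SmoothLT.u_zero : B.SmoothLT 1 fun z => z.u 0 := SmoothLT.coord_u one_pos

theorem SmoothLT.jetRHS_coeff_two (hb : B.SmoothLT 0 b) :
    B.SmoothLT 1 fun z => pd .x b z * z.u 0 ^ 2 :=
  ((hb.smooth_pd _).mono zero_le_one).mul (SmoothLT.u_zero.pow 2)

theorem SmoothLT.jetRHS_coeff_one (hb : B.SmoothLT 0 b) :
    B.SmoothLT 1 fun z => 2 * pd .x (pd .x b) z * z.u 0 ^ 2 + 4 * b z :=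
  (((SmoothLT.const 1 2).mul (((hb.smooth_pd _).smooth_pd _).mono zero_le_one)).mul
    (SmoothLT.u_zero.pow 2)).add ((SmoothLT.const 1 4).mul (hb.mono zero_le_one))

theorem SmoothLT.jetRHS_coeff_zero (hb : B.SmoothLT 0 b) : B.SmoothLT 1 fun z =>
    (pd .x (pd .x (pd .x b)) z - 4 * pd .x b z) * z.u 0 ^ 3 - 4 * pd .x b z * z.u 0 := by
  have h1 := (hb.smooth_pd .x).mono zero_le_one
  have h3 := ((hb.smooth_pd .x).smooth_pd .x).smooth_pd .x |>.mono zero_le_one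
  have h4 := (SmoothLT.const 1 4).mul h1
  exact ((h3.sub h4).mul (SmoothLT.u_zero.pow 3)).sub (h4.mul SmoothLT.u_zero)

theorem SmoothLT.jetRHS_lower (hb : B.SmoothLT 0 b) : B.SmoothLT 2 fun z =>
    (2 * pd .x (pd .x b) z * z.u 0 ^ 2 + 4 * b z) * z.u 1
      + ((pd .x (pd .x (pd .x b)) z - 4 * pd .x b z) * z.u 0 ^ 3 - 4 * pd .x b z * z.u 0) :=
  ((hb.jetRHS_coeff_one.mono one_le_two).mul (SmoothLT.coord_u one_lt_two)).add
    (hb.jetRHS_coeff_zero.mono one_le_two)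

theorem SmoothLT.jetRHS (hb : B.SmoothLT 0 b) : B.SmoothLT 3 (jetRHS b) :=
  ((hb.jetRHS_coeff_two.mono (by omega)).mul (SmoothLT.coord_u (by omega))).add
    (hb.jetRHS_lower.mono (by omega))

theorem pd_u_two_jetRHS (hb : B.SmoothLT 0 b) (hz : z ∈ B.carrier) :
    pd (.u 2) (_root_.jetRHS b) z = pd .x b z * z.u 0 ^ 2 := by
  have h2 : B.SmoothLT 3 fun z => z.u 2 := SmoothLT.coord_u (by omega)
  have h := hb.jetRHS_coeff_two.mono (show 1 ≤ 3 by omega)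
  have h0 : pd (.u 2) (_root_.jetRHS b) z = _ := pd_add (h.mul h2) hb.jetRHS_lower (.u 2) hz
  rw [h0, pd_mul h h2 _ hz, hb.jetRHS_lower.pd_u_eq_zero le_rfl hz,
    hb.jetRHS_coeff_two.pd_u_eq_zero one_le_two hz, pd_coord_u_self]
  ring

/-- The determining equations for densities of order zero. -/
theorem IsConservationLaw.determining (hb : B.SmoothLT 0 b)
    (hl : B.IsConservationLaw (jetRHS b) ρ σ) (hρ : B.SmoothLT 1 ρ) :
    ∃ τ, B.SmoothLT 1 τ ∧ ∀ z ∈ B.carrier,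
      pd (.u 0) (fun z => pd .x b z * z.u 0 ^ 2 * pd (.u 0) ρ z) z = 0 ∧
      (2 * pd .x (pd .x b) z * z.u 0 ^ 2 + 4 * b z) * pd (.u 0) ρ z =
        pd .x (fun z => pd .x b z * z.u 0 ^ 2 * pd (.u 0) ρ z) z + pd (.u 0) τ z ∧
      pd .t ρ z + ((pd .x (pd .x (pd .x b)) z - 4 * pd .x b z) * z.u 0 ^ 3
        - 4 * pd .x b z * z.u 0) * pd (.u 0) ρ z = pd .x τ z := by
  obtain ⟨-, ⟨m, hσ⟩, hlaw⟩ := hl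
  replace hσ : B.SmoothLT m σ := hσ
  have hρ0 := hρ.smooth_pd (.u 0)
  set w : JetPoint → ℝ := fun z => pd .x b z * z.u 0 ^ 2 * pd (.u 0) ρ z with hw
  have hws : B.SmoothLT 1 w := hb.jetRHS_coeff_two.mul hρ0
  have hu1 : B.SmoothLT 2 fun z => z.u 1 := SmoothLT.coord_u one_lt_two
  have hwu : B.SmoothLT 2 fun z => w z * z.u 1 := (hws.mono one_le_two).mul hu1
  -- D_x(w u_x) contains the whole u_xx term of D_tρ. The reduced flux has a total derivative free
  -- of u_xx, so it depends on t, x, u only.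
  have hτs : B.SmoothLT (max m 2) fun z => σ z - w z * z.u 1 :=
    (hσ.mono (le_max_left _ _)).sub (hwu.mono (le_max_right _ _))
  have hC1 := hb.jetRHS_coeff_one
  have hC0 := hb.jetRHS_coeff_zero
  have hA := (hρ.smooth_pd .t).add (hC0.mul hρ0)
  have hB' := (hC1.mul hρ0).sub (hws.smooth_pd .x)
  have hC := hws.smooth_pd (.u 0)
  have hD : Set.EqOn (totalDx fun z => σ z - w z * z.u 1) (fun z =>
      (pd .t ρ z + ((pd .x (pd .x (pd .x b)) z - 4 * pd .x b z) * z.u 0 ^ 3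
        - 4 * pd .x b z * z.u 0) * pd (.u 0) ρ z)
      + ((2 * pd .x (pd .x b) z * z.u 0 ^ 2 + 4 * b z) * pd (.u 0) ρ z - pd .x w z) * z.u 1
      - pd (.u 0) w z * z.u 1 ^ 2) B.carrier := fun z hz => by
    rw [totalDx_sub hσ hwu hz, totalDx_mul hws hu1 hz, ← hlaw z hz, hρ.totalDt_eq le_rfl hz,
      hws.totalDx_eq le_rfl hz, totalDx_coord_u 1 hz]
    simp only [Finset.sum_range_one, Function.iterate_zero, id, jetRHS, hw]
    ring
  have hτ : B.SmoothLT 1 fun z => σ z - w z * z.u 1 := hτs.of_totalDx <| SmoothLT.congr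
    (((hA.mono one_le_two).add ((hB'.mono one_le_two).mul hu1)).sub
      ((hC.mono one_le_two).mul (hu1.pow 2))) hD
  refine ⟨_, hτ, fun z hz => ?_⟩
  obtain ⟨e0, e1, e2⟩ := SmoothLT.quadratic_coeff_eq_zero (k := 1)
    (hA.sub (hτ.smooth_pd .x)) (hB'.sub (hτ.smooth_pd (.u 0))) hC.neg (fun z hz => by
      have h1 := hτ.totalDx_eq le_rfl hz
      rw [hD hz] at h1
      simp only [Finset.sum_range_one] at h1
      linear_combination h1) hz
  refine ⟨neg_eq_zero.1 e2, ?_, ?_⟩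
  · linear_combination e1
  · linear_combination e0

section

variable (hB : (0 : ℝ) ∉ B.U 0)
include hB

theorem SmoothLT.div_u (hh : B.SmoothLT 0 h) : B.SmoothLT 1 fun z => h z * (1 / z.u 0) :=
  (hh.mono zero_le_one).mul (smoothLT_inv_u hB)

theorem pd_u_div_u (hh : B.SmoothLT 0 h) (hz : z ∈ B.carrier) :
    pd (.u 0) (fun z => h z * (1 / z.u 0)) z = - h z / z.u 0 ^ 2 := by
  rw [pd_mul hh (smoothLT_inv_u hB) _ hz, hh.pd_u_eq_zero le_rfl hz, pd_u_inv_u hB hz]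
  ring

theorem pd_div_u (hh : B.SmoothLT 0 h) {i : JetCoord} (hi : i ≠ .u 0) (hz : z ∈ B.carrier) :
    pd i (fun z => h z * (1 / z.u 0)) z = pd i h z / z.u 0 := by
  rw [pd_mul hh (smoothLT_inv_u hB) _ hz, pd_inv_u_of_ne hB hi hz]
  ring

theorem IsConservationLaw.div_u_equations (hb : B.SmoothLT 0 b)
    (hbx : ∀ z ∈ B.carrier, pd .x b z ≠ 0) (hh : B.SmoothLT 0 h)
    (hl : B.IsConservationLaw (jetRHS b) (fun z => h z * (1 / z.u 0)) σ) (hz : z ∈ B.carrier) :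
    pd .x (pd .x h) z = 4 * h z ∧ pd .t h z = 4 * b z * pd .x h z := by
  obtain ⟨τ, hτ, hdet⟩ := hl.determining hb (hh.div_u hB)
  have hb1 := hb.smooth_pd .x
  have hb2 := hb1.smooth_pd .x
  have hh1 := hh.smooth_pd .x
  have hw : Set.EqOn (fun z => pd .x b z * z.u 0 ^ 2 * pd (.u 0) (fun z => h z * (1 / z.u 0)) z)
      (fun z => - (pd .x b z * h z)) B.carrier := fun z hz => by
    have h0 := u_zero_ne_zero hB hz
    simp only [pd_u_div_u hB hh hz]
    field_simp
  have hP : B.SmoothLT 0 fun z => pd .x h z * pd .x b z - h z * pd .x (pd .x b) z :=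
    (hh1.mul hb1).sub (hh.mul hb2)
  have hQ : B.SmoothLT 0 fun z => 4 * (b z * h z) := (SmoothLT.const 0 4).mul (hb.mul hh)
  have hPu : B.SmoothLT 1 fun z =>
      (pd .x h z * pd .x b z - h z * pd .x (pd .x b) z) * z.u 0 :=
    (hP.mono zero_le_one).mul SmoothLT.u_zero
  have hQu := hQ.div_u hB
  -- Here w = -b_x h, and the second determining equation integrates in u to τ = (h_x b_x - h b_xx)
  -- u + 4bh/u + κ(t, x).
  have hκ : B.SmoothLT 0 fun z => τ z -
      ((pd .x h z * pd .x b z - h z * pd .x (pd .x b) z) * z.u 0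
        + 4 * (b z * h z) * (1 / z.u 0)) := by
    refine (hτ.sub (hPu.add hQu)).of_pd_u_eq_zero fun z hz => ?_
    have h0 := u_zero_ne_zero hB hz
    obtain ⟨-, h1, -⟩ := hdet z hz
    rw [pd_congr hw _ hz, pd_neg, pd_mul hb1 hh _ hz, pd_u_div_u hB hh hz] at h1
    rw [pd_sub hτ (hPu.add hQu) _ hz, pd_add hPu hQu _ hz, pd_u_div_u hB hQ hz,
      pd_mul hP SmoothLT.u_zero _ hz, hP.pd_u_eq_zero le_rfl hz, pd_coord_u_self]
    field_simp at h1 ⊢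
    linear_combination -h1
  have hκx := hκ.smooth_pd .x
  -- Multiplied by u, the third determining equation is quadratic in u; b_xxx cancels, and the
  -- coefficients of 1 and u² give the two claims.
  obtain ⟨e0, -, e2⟩ := SmoothLT.quadratic_coeff_eq_zero (k := 0) (z := z)
    (a := fun z => pd .t h z - 4 * (b z * pd .x h z)) (c := fun z =>
      4 * (h z * pd .x b z) - pd .x (pd .x h) z * pd .x b z)
    ((hh.smooth_pd .t).sub ((SmoothLT.const 0 4).mul (hb.mul hh1))) hκx.neg
    (((SmoothLT.const 0 4).mul (hh.mul hb1)).sub ((hh1.smooth_pd .x).mul hb1)) (fun z hz => by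
      have h0 := u_zero_ne_zero hB hz
      obtain ⟨-, -, h1⟩ := hdet z hz
      rw [pd_u_div_u hB hh hz, pd_div_u hB hh (by simp) hz] at h1
      have h2 : pd .x (fun z => τ z -
          ((pd .x h z * pd .x b z - h z * pd .x (pd .x b) z) * z.u 0
            + 4 * (b z * h z) * (1 / z.u 0))) z = pd .x τ z -
          ((pd .x (pd .x h) z * pd .x b z - h z * pd .x (pd .x (pd .x b)) z) * z.u 0
            + 4 * (pd .x b z * h z + b z * pd .x h z) / z.u 0) := by
        rw [pd_sub hτ (hPu.add hQu) _ hz, pd_add hPu hQu _ hz, pd_div_u hB hQ (by simp) hz,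
          pd_mul hP SmoothLT.u_zero _ hz, pd_coord_u_of_ne (by simp),
          pd_sub (hh1.mul hb1) (hh.mul hb2) _ hz, pd_mul hh1 hb1 _ hz, pd_mul hh hb2 _ hz,
          pd_const_mul, pd_mul hb hh _ hz]
        ring
      rw [h2, ← h1]
      field_simp
      ring) hz
  refine ⟨?_, by linear_combination e0⟩
  have : (4 * h z - pd .x (pd .x h) z) * pd .x b z = 0 := by linear_combination e2
  linear_combination -(mul_eq_zero.1 this).resolve_right (hbx z hz)

/-- Up to trivial laws, every density is `h / u`, where `h_xx = 4 h` and `h_t = 4 b h_x`. -/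
theorem IsConservationLaw.exists_density (hb : B.SmoothLT 0 b)
    (hbx : ∀ z ∈ B.carrier, pd .x b z ≠ 0) (hl : B.IsConservationLaw (jetRHS b) ρ σ) :
    ∃ h n f, B.SmoothLT 0 h ∧ B.SmoothLT n f ∧
      (∀ z ∈ B.carrier, ρ z - totalDx f z = h z * (1 / z.u 0)) ∧
      ∀ z ∈ B.carrier, pd .x (pd .x h) z = 4 * h z ∧ pd .t h z = 4 * b z * pd .x h z := by
  have hF := hb.jetRHS
  have ha : Set.EqOn (pd (.u 2) (jetRHS b)) (fun z => pd .x b z * z.u 0 ^ 2) B.carrier :=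
    fun z hz => pd_u_two_jetRHS hb hz
  obtain ⟨n, f, hf, hρ⟩ := hl.exists_sub_totalDx_order_zero hF
    ((hb.jetRHS_coeff_two.congr ha).mono one_le_two) fun z hz => by
      rw [ha hz]
      exact mul_ne_zero (hbx z hz) (pow_ne_zero 2 (u_zero_ne_zero hB hz))
  have hl1 := hl.sub_totalDx hF hf
  obtain ⟨τ, -, hdet⟩ := hl1.determining hb hρ
  have hw : B.SmoothLT 0 fun z =>
      pd .x b z * z.u 0 ^ 2 * pd (.u 0) (fun z => ρ z - totalDx f z) z :=
    (hb.jetRHS_coeff_two.mul (hρ.smooth_pd _)).of_pd_u_eq_zero fun z hz => (hdet z hz).1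
  -- The first determining equation makes w = b_x u² ρ_u free of u, so ρ_u = -h/u² with h = -w/b_x.
  set h : JetPoint → ℝ := fun z =>
    -(pd .x b z * z.u 0 ^ 2 * pd (.u 0) (fun z => ρ z - totalDx f z) z) / pd .x b z with hh_def
  have hh : B.SmoothLT 0 h := hw.neg.div (hb.smooth_pd .x) hbx
  have hg : B.SmoothLT 0 fun z => (ρ z - totalDx f z) - h z * (1 / z.u 0) := by
    refine (hρ.sub (hh.div_u hB)).of_pd_u_eq_zero fun z hz => ?_
    have h0 := u_zero_ne_zero hB hz
    have h1 := hbx z hz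
    rw [pd_sub hρ (hh.div_u hB) _ hz, pd_u_div_u hB hh hz, hh_def]
    field_simp
    ring
  -- The remainder depends on t and x only, so it is D_x of its x-primitive.
  obtain ⟨G, hG, hGg⟩ := hg.exists_primitive .x (by simp)
  have hfG : B.SmoothLT n fun z => f z + G z := hf.add (hG.mono (Nat.zero_le n))
  have hρ' : ∀ z ∈ B.carrier, ρ z - totalDx (fun z => f z + G z) z = h z * (1 / z.u 0) :=
    fun z hz => by
    rw [totalDx_add hf hG hz, hG.totalDx_eq_pd hz, hGg z hz]
    ring
  refine ⟨h, n, _, hh, hfG, hρ', fun z hz => ?_⟩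
  have hl2 := hl.sub_totalDx hF hfG
  refine IsConservationLaw.div_u_equations hB hb hbx hh
    (σ := fun z => σ z - totalDt (jetRHS b) (fun z => f z + G z) z) ?_ hz
  refine ⟨⟨1, hh.div_u hB⟩, hl2.flux, fun z hz => ?_⟩
  rw [← hl2.law z hz]
  exact totalDt_congr (fun z hz => (hρ' z hz).symm) hz

/-- The flux is the one found by integrating the determining equations for h/u, with κ = 0. -/
theorem isConservationLaw_div_u (hb : B.SmoothLT 0 b) (hh : B.SmoothLT 0 h)
    (hhx : ∀ z ∈ B.carrier, pd .x (pd .x h) z = 4 * h z)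
    (hht : ∀ z ∈ B.carrier, pd .t h z = 4 * b z * pd .x h z) :
    B.IsConservationLaw (jetRHS b) (fun z => h z * (1 / z.u 0)) fun z =>
      -(h z * pd .x b z) * z.u 1 + ((pd .x h z * pd .x b z - h z * pd .x (pd .x b) z) * z.u 0
        + 4 * (b z * h z) * (1 / z.u 0)) := by
  have hb1 := hb.smooth_pd .x
  have hb2 := hb1.smooth_pd .x
  have hh1 := hh.smooth_pd .x
  have hP : B.SmoothLT 0 fun z => pd .x h z * pd .x b z - h z * pd .x (pd .x b) z :=
    (hh1.mul hb1).sub (hh.mul hb2)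
  have hQ : B.SmoothLT 0 fun z => 4 * (b z * h z) := (SmoothLT.const 0 4).mul (hb.mul hh)
  have hR : B.SmoothLT 0 fun z => -(h z * pd .x b z) := (hh.mul hb1).neg
  have hu1 : B.SmoothLT 2 fun z => z.u 1 := SmoothLT.coord_u one_lt_two
  have hPu : B.SmoothLT 1 fun z =>
      (pd .x h z * pd .x b z - h z * pd .x (pd .x b) z) * z.u 0 :=
    (hP.mono zero_le_one).mul SmoothLT.u_zero
  have hQu := hQ.div_u hB
  have hRu : B.SmoothLT 2 fun z => -(h z * pd .x b z) * z.u 1 := (hR.mono zero_le_two).mul hu1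
  refine ⟨⟨1, hh.div_u hB⟩, ⟨2, hRu.add ((hPu.add hQu).mono one_le_two)⟩, fun z hz => ?_⟩
  have h0 := u_zero_ne_zero hB hz
  rw [(hh.div_u hB).totalDt_eq le_rfl hz, totalDx_add hRu (hPu.add hQu) hz,
    totalDx_add hPu hQu hz, totalDx_mul hR hu1 hz, totalDx_mul hP SmoothLT.u_zero hz,
    totalDx_mul hQ (smoothLT_inv_u hB) hz, totalDx_coord_u 1 hz, totalDx_coord_u 0 hz,
    totalDx_inv_u hB hz, hR.totalDx_eq_pd hz, hP.totalDx_eq_pd hz, hQ.totalDx_eq_pd hz,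
    pd_neg, pd_mul hh hb1 _ hz, pd_sub (hh1.mul hb1) (hh.mul hb2) _ hz, pd_mul hh1 hb1 _ hz,
    pd_mul hh hb2 _ hz, pd_const_mul, pd_mul hb hh _ hz, pd_div_u hB hh (by simp) hz]
  simp only [Finset.sum_range_one, Function.iterate_zero, id, pd_u_div_u hB hh hz, jetRHS,
    hhx z hz, hht z hz]
  field_simp
  ring

/-- If h/u = D_x f, the order count leaves f = f(t, x), so D_x f is free of u, while ∂_u(h/u) =
-h/u². -/
theorem eq_zero_of_isTrivialLaw_div_u (hh : B.SmoothLT 0 h) {F : JetPoint → ℝ}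
    (ht : B.IsTrivialLaw F (fun z => h z * (1 / z.u 0)) σ) (hz : z ∈ B.carrier) : h z = 0 := by
  obtain ⟨f, ⟨n, hf⟩, hl⟩ := ht
  replace hf : B.SmoothLT n f := hf
  have he : Set.EqOn (totalDx f) (fun z => h z * (1 / z.u 0)) B.carrier :=
    fun z hz => (hl z hz).1.symm
  have hf0 : B.SmoothLT 0 f := hf.of_totalDx ((hh.div_u hB).congr he)
  have he' : Set.EqOn (fun z => h z * (1 / z.u 0)) (pd .x f) B.carrier :=
    fun z hz => (he hz).symm.trans (hf0.totalDx_eq_pd hz)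
  have h1 := pd_u_div_u hB hh hz
  rw [pd_congr he' _ hz, (hf0.smooth_pd .x).pd_u_eq_zero le_rfl hz] at h1
  have h0 := u_zero_ne_zero hB hz
  field_simp at h1
  linarith

end

end JetBox

/-! ### Rigidity of the overdetermined system h_xx = 4h, h_t = 4b h_x. -/

namespace JetBox

variable {B : JetBox} {n m : ℕ} {f y c b h : JetPoint → ℝ} {z : JetPoint}

theorem SmoothLT.exp (hf : B.SmoothLT n f) : B.SmoothLT n fun z => Real.exp (f z) := by
  obtain ⟨g, hg, hfg⟩ := hf
  exact ⟨fun y => Real.exp (g y), hg.exp, fun z hz => by simp only [hfg z hz]⟩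

theorem pd_exp (hf : B.SmoothLT n f) (i : JetCoord) (hz : z ∈ B.carrier) :
    pd i (fun z => Real.exp (f z)) z = Real.exp (f z) * pd i f z := by
  have := (hf.hasDerivAt i hz).exp.deriv
  simp only [set_get] at this
  exact this

theorem SmoothLT.eq_of_tx (hf : B.SmoothLT 0 f) {z z' : JetPoint} (hz : z ∈ B.carrier)
    (hz' : z' ∈ B.carrier) (ht : z.t = z'.t) (hx : z.x = z'.x) : f z = f z' := by
  obtain ⟨g, -, hfg⟩ := hf
  rw [hfg z hz, hfg z' hz']
  simp only [proj, ht, hx]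
  congr 3
  exact Subsingleton.elim _ _

theorem SmoothLT.contDiffOn_tx (hf : B.SmoothLT 0 f) (hz : z ∈ B.carrier) :
    ContDiffOn ℝ ∞ (fun y : ℝ × ℝ => f ⟨y.1, y.2, z.u⟩) (B.I ×ˢ B.J) := by
  obtain ⟨g, hg, hfg⟩ := hf
  have h1 : ContDiffOn ℝ ∞ (fun y : ℝ × ℝ => g (y.1, y.2, fun i : Fin 0 => z.u i)) (B.I ×ˢ B.J) :=
    hg.comp (ContDiff.contDiffOn (by fun_prop)) fun y hy => ⟨hy.1, hy.2, fun i => i.elim0⟩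
  exact h1.congr fun y hy => hfg _ ⟨hy.1, hy.2, hz.2.2⟩

/-- With the integrating factor e^{-C}, where C is a primitive of c in the i-th coordinate, y e^{-C}
is constant in that coordinate. -/
theorem SmoothLT.eq_zero_of_linear_ode (hy : B.SmoothLT n y) (hc : B.SmoothLT n c) {i : JetCoord}
    (hi : ∀ k, i = .u k → k < n) (hyc : ∀ z ∈ B.carrier, pd i y z = c z * y z)
    (hz : z ∈ B.carrier) (h0 : y z = 0) {s : ℝ} (hs : s ∈ B.range i) : y (z.set i s) = 0 := by
  obtain ⟨C, hC, hCc⟩ := hc.exists_primitive i hi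
  have hyC := hy.mul hC.neg.exp
  have h1 := hyC.eq_set_of_pd_eq_zero (i := i) (fun z hz => by
    rw [pd_mul hy hC.neg.exp _ hz, pd_exp hC.neg _ hz, pd_neg, hyc z hz, hCc z hz]
    ring) hz hs
  rw [h0, zero_mul] at h1
  exact (mul_eq_zero.1 h1).resolve_right (Real.exp_ne_zero _)

/-- If `h_xx = 4 h` and `h_t = 4 b h_x` with `b_x ≠ 0`, then `h_x` has no zeros unless `h = 0`. -/
theorem SmoothLT.eq_zero_of_pd_x_eq_zero (hb : B.SmoothLT 0 b)
    (hbx : ∀ z ∈ B.carrier, pd .x b z ≠ 0) (hh : B.SmoothLT 0 h)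
    (hhx : ∀ z ∈ B.carrier, pd .x (pd .x h) z = 4 * h z)
    (hht : ∀ z ∈ B.carrier, pd .t h z = 4 * b z * pd .x h z)
    {z₀ : JetPoint} (hz₀ : z₀ ∈ B.carrier) (h0 : pd .x h z₀ = 0) (hz : z ∈ B.carrier) :
    h z = 0 := by
  have hb1 := hb.smooth_pd .x
  have hb2 := hb1.smooth_pd .x
  have hy := hh.smooth_pd .x
  have hby := ((SmoothLT.const 0 4).mul hb).mul hy
  have hyt : Set.EqOn (pd .t (pd .x h)) (fun z => 4 * pd .x b z * pd .x h z + 16 * (b z * h z))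
      B.carrier := fun z hz => by
    rw [hh.pd_comm .t .x hz, pd_congr hht _ hz, pd_mul ((SmoothLT.const 0 4).mul hb) hy _ hz,
      pd_const_mul, hhx z hz]
    ring
  -- Computing h_xxt from each equation gives 16 b h_x = 4 b_xx h_x + 32 b_x h + 16 b h_x.
  have key : ∀ z ∈ B.carrier, h z = -(pd .x (pd .x b) z / (8 * pd .x b z)) * pd .x h z :=
    fun z hz => by
    have h1 := hy.pd_comm .t .x hz
    rw [pd_congr hhx _ hz, pd_congr hyt _ hz, pd_const_mul, hht z hz,
      pd_add (((SmoothLT.const 0 4).mul hb1).mul hy) ((SmoothLT.const 0 16).mul (hb.mul hh)) _ hz,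
      pd_mul ((SmoothLT.const 0 4).mul hb1) hy _ hz, pd_const_mul, pd_const_mul,
      pd_mul hb hh _ hz, hhx z hz] at h1
    have h2 := hbx z hz
    field_simp
    linear_combination -h1 / 4
  have ha : B.SmoothLT 0 fun z => -(pd .x (pd .x b) z / (8 * pd .x b z)) :=
    (hb2.div ((SmoothLT.const 0 8).mul hb1) fun z hz => mul_ne_zero (by norm_num) (hbx z hz)).neg
  -- Substituting `key` makes the equations for h_xt and h_xx linear and homogeneous in h_x; the
  -- zero spreads first along t, then along x.
  have e1 : pd .x h (z₀.set .t z.t) = 0 := hy.eq_zero_of_linear_ode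
    (((SmoothLT.const 0 4).mul hb1).add ((SmoothLT.const 0 16).mul (hb.mul ha))) (by simp)
    (fun z hz => by
      rw [hyt hz]
      simp only
      rw [key z hz]
      ring) hz₀ h0 hz.1
  have hz₁ : z₀.set .t z.t ∈ B.carrier := set_mem hz₀ hz.1
  have e2 : pd .x h ((z₀.set .t z.t).set .x z.x) = 0 := hy.eq_zero_of_linear_ode
    ((SmoothLT.const 0 4).mul ha) (by simp) (fun z hz => by
      rw [hhx z hz, key z hz]
      ring) hz₁ e1 hz.2.1
  rw [key z hz, hy.eq_of_tx (z' := (z₀.set .t z.t).set .x z.x) hz (set_mem hz₁ hz.2.1) rfl rfl, e2,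
    mul_zero]

end JetBox

/-! ### The special parameter and its x-derivatives. -/

/-- The function `p e^{2x} + q e^{-2x}`. -/
def expSum (p q : ℝ → ℝ) (z : JetPoint) : ℝ :=
  p z.t * Real.exp (2 * z.x) + q z.t * Real.exp (-2 * z.x)

/-- The function `p e^{2x} - q e^{-2x}`. -/
def expDiff (p q : ℝ → ℝ) (z : JetPoint) : ℝ :=
  p z.t * Real.exp (2 * z.x) - q z.t * Real.exp (-2 * z.x)

theorem pd_x_expSum (p q : ℝ → ℝ) (z : JetPoint) : pd .x (expSum p q) z = 2 * expDiff p q z := by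
  have h1 : ∀ c : ℝ, HasDerivAt (fun s => Real.exp (c * s)) (Real.exp (c * z.x) * c) z.x := fun c =>
    (((hasDerivAt_id z.x).const_mul c).exp).congr_deriv (by simp)
  have h2 : pd .x (expSum p q) z = _ :=
    (((h1 2).const_mul (p z.t)).add ((h1 (-2)).const_mul (q z.t))).deriv
  rw [h2, expDiff]
  ring

theorem expDiff_eq_expSum (p q : ℝ → ℝ) : expDiff p q = expSum p (-q) := by
  funext z; simp [expDiff, expSum, sub_eq_add_neg]

theorem pd_x_expDiff (p q : ℝ → ℝ) (z : JetPoint) : pd .x (expDiff p q) z = 2 * expSum p q z := by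
  rw [expDiff_eq_expSum, pd_x_expSum, expDiff_eq_expSum, neg_neg]

namespace JetBox

variable {B : JetBox} {p q : ℝ → ℝ} {b : JetPoint → ℝ} {z : JetPoint}

theorem smoothLT_of_t (hp : ContDiffOn ℝ ∞ p B.I) : B.SmoothLT 0 fun z => p z.t :=
  SmoothLT.of_tx (a := fun t _ => p t) (hp.comp contDiffOn_fst fun _ hy => hy.1)

theorem smoothLT_exp_mul_x (c : ℝ) : B.SmoothLT 0 fun z => Real.exp (c * z.x) :=
  SmoothLT.of_tx (a := fun _ x => Real.exp (c * x)) (ContDiff.contDiffOn (by fun_prop))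

theorem smoothLT_expSum (hp : ContDiffOn ℝ ∞ p B.I) (hq : ContDiffOn ℝ ∞ q B.I) :
    B.SmoothLT 0 (expSum p q) :=
  ((smoothLT_of_t hp).mul (smoothLT_exp_mul_x 2)).add
    ((smoothLT_of_t hq).mul (smoothLT_exp_mul_x (-2)))

theorem smoothLT_expDiff (hp : ContDiffOn ℝ ∞ p B.I) (hq : ContDiffOn ℝ ∞ q B.I) :
    B.SmoothLT 0 (expDiff p q) :=
  ((smoothLT_of_t hp).mul (smoothLT_exp_mul_x 2)).sub
    ((smoothLT_of_t hq).mul (smoothLT_exp_mul_x (-2)))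

theorem hasDerivAt_of_contDiffOn (hp : ContDiffOn ℝ ∞ p B.I) {t : ℝ} (ht : t ∈ B.I) :
    HasDerivAt p (deriv p t) t :=
  ((hp.contDiffAt (B.isOpen_I.mem_nhds ht)).differentiableAt (by simp)).hasDerivAt

theorem pd_t_expSum (hp : ContDiffOn ℝ ∞ p B.I) (hq : ContDiffOn ℝ ∞ q B.I)
    (hz : z ∈ B.carrier) : pd .t (expSum p q) z = expSum (deriv p) (deriv q) z :=
  (((hasDerivAt_of_contDiffOn hp hz.1).mul_const (Real.exp (2 * z.x))).add
    ((hasDerivAt_of_contDiffOn hq hz.1).mul_const (Real.exp (-2 * z.x)))).deriv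

theorem deriv_mul_of_contDiffOn (hp : ContDiffOn ℝ ∞ p B.I) (hq : ContDiffOn ℝ ∞ q B.I) {t : ℝ}
    (ht : t ∈ B.I) : deriv (fun s => p s * q s) t = deriv p t * q t + p t * deriv q t :=
  ((hasDerivAt_of_contDiffOn hp ht).mul (hasDerivAt_of_contDiffOn hq ht)).deriv

theorem contDiffOn_deriv (hp : ContDiffOn ℝ ∞ p B.I) : ContDiffOn ℝ ∞ (deriv p) B.I :=
  ((contDiffOn_infty_iff_deriv_of_isOpen B.isOpen_I).1 hp).2

theorem exp_two_mul_exp_neg_two (x : ℝ) : Real.exp (2 * x) * Real.exp (-2 * x) = 1 := by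
  rw [← Real.exp_add, ← Real.exp_zero]
  congr 1
  ring

section Parameter

variable (hp : ContDiffOn ℝ ∞ p B.I) (hq : ContDiffOn ℝ ∞ q B.I)
  (hD : ∀ z ∈ B.carrier, expDiff p q z ≠ 0)
  (hb : ∀ z ∈ B.carrier, b z = 1 / 8 * (expSum (deriv p) (deriv q) z / expDiff p q z))
include hp hq hD hb

theorem smoothLT_parameter : B.SmoothLT 0 b :=
  ((SmoothLT.const 0 (1 / 8)).mul ((smoothLT_expSum (contDiffOn_deriv hp)
    (contDiffOn_deriv hq)).div (smoothLT_expDiff hp hq) hD)).congr hb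

/-- In the numerator of the quotient rule the e^{±4x} terms cancel, leaving a constant multiple of
(pq)_t. -/
theorem pd_x_parameter (hz : z ∈ B.carrier) :
    pd .x b z = (-1 / 2) * (deriv (fun s => p s * q s) z.t / expDiff p q z ^ 2) := by
  have hT := smoothLT_expSum (contDiffOn_deriv hp) (contDiffOn_deriv hq)
  rw [pd_congr hb _ hz, pd_const_mul, pd_div hT (smoothLT_expDiff hp hq) _ hz (hD z hz),
    pd_x_expSum, pd_x_expDiff, deriv_mul_of_contDiffOn hp hq hz.1]
  have h0 := hD z hz
  field_simp
  simp only [expDiff, expSum]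
  linear_combination (-8 * (deriv p z.t * q z.t + p z.t * deriv q z.t)) *
    exp_two_mul_exp_neg_two z.x

theorem pd_x_pd_x_parameter (hz : z ∈ B.carrier) :
    pd .x (pd .x b) z =
      2 * (deriv (fun s => p s * q s) z.t * expSum p q z) / expDiff p q z ^ 3 := by
  have hw : B.SmoothLT 0 fun z => deriv (fun s => p s * q s) z.t :=
    smoothLT_of_t (contDiffOn_deriv (hp.mul hq))
  have hDs := smoothLT_expDiff hp hq
  have hD2 : B.SmoothLT 0 fun z => expDiff p q z * expDiff p q z := hDs.mul hDs
  have h1 : Set.EqOn (pd .x b) (fun z => (-1 / 2) *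
      (deriv (fun s => p s * q s) z.t / (expDiff p q z * expDiff p q z))) B.carrier := fun z hz => by
    rw [pd_x_parameter hp hq hD hb hz, sq]
  have h0 := hD z hz
  have h2 : pd .x (fun z => deriv (fun s => p s * q s) z.t) z = 0 := by simp [pd, JetPoint.set]
  rw [pd_congr h1 _ hz, pd_const_mul, pd_div hw hD2 _ hz (mul_ne_zero h0 h0),
    pd_mul hDs hDs _ hz, pd_x_expDiff, h2]
  field_simp
  ring

end Parameter

end JetBox

/-! ### The explicit law, its uniqueness, and the necessity of the special form. -/

theorem evolutionRHS_eq_jetRHS (β : ℝ → ℝ → ℝ) :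
    evolutionRHS β = jetRHS fun z => β z.t z.x := by
  funext z
  have h1 : pd .x (fun z => β z.t z.x) = fun z => deriv (β z.t) z.x := rfl
  have h2 : pd .x (pd .x fun z => β z.t z.x) = fun z => deriv (deriv (β z.t)) z.x := rfl
  have h3 : pd .x (pd .x (pd .x fun z => β z.t z.x)) =
    fun z => deriv (deriv (deriv (β z.t))) z.x := rfl
  rw [evolutionRHS, jetRHS, h3, h2, h1]
  simp only [iteratedDeriv_succ, iteratedDeriv_zero]
  ring

namespace JetBox

variable {B : JetBox} {β : ℝ → ℝ → ℝ} {p q : ℝ → ℝ} {F ρ σ ρ' σ' : JetPoint → ℝ} {z : JetPoint}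

theorem IsConservationLaw.congr (h : B.IsConservationLaw F ρ σ) (hρ : Set.EqOn ρ' ρ B.carrier)
    (hσ : Set.EqOn σ' σ B.carrier) : B.IsConservationLaw F ρ' σ' := by
  obtain ⟨⟨n, hn⟩, ⟨m, hm⟩, hl⟩ := h
  replace hn : B.SmoothLT n ρ := hn
  replace hm : B.SmoothLT m σ := hm
  refine ⟨⟨n, hn.congr hρ⟩, ⟨m, hm.congr hσ⟩, fun z hz => ?_⟩
  rw [totalDt_congr hρ hz, totalDx_congr hσ hz, hl z hz]

theorem exists_mem_carrier {t x : ℝ} (ht : t ∈ B.I) (hx : x ∈ B.J) :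
    ∃ z ∈ B.carrier, z.t = t ∧ z.x = x := by
  obtain ⟨z, hz⟩ := B.carrier_nonempty
  exact ⟨⟨t, x, z.u⟩, ⟨ht, hx, hz.2.2⟩, rfl, rfl⟩

theorem IsParameter.smoothLT (h : B.IsParameter β) : B.SmoothLT 0 fun z => β z.t z.x :=
  SmoothLT.of_tx h.smooth

theorem IsParameter.pd_x_ne_zero (h : B.IsParameter β) (hz : z ∈ B.carrier) :
    pd .x (fun z => β z.t z.x) z ≠ 0 := h.deriv_ne_zero _ hz.1 _ hz.2.1

theorem pd_x_pd_x_expSum (p q : ℝ → ℝ) (z : JetPoint) :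
    pd .x (pd .x (expSum p q)) z = 4 * expSum p q z := by
  have h1 : pd .x (expSum p q) = fun z => 2 * expDiff p q z := funext (pd_x_expSum p q)
  rw [h1, pd_const_mul, pd_x_expDiff]
  ring

theorem specialDensity_eq (p q : ℝ → ℝ) :
    specialDensity p q = fun z => expSum p q z * (1 / z.u 0) := by
  funext z
  rw [specialDensity, expSum]
  ring

namespace IsSpecialParameter

variable (h : B.IsSpecialParameter β p q)
include h

theorem expDiff_ne_zero : ∀ z ∈ B.carrier, expDiff p q z ≠ 0 :=
  fun _ hz => h.denom_ne_zero _ hz.1 _ hz.2.1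

theorem eq_expSum_div : ∀ z ∈ B.carrier,
    β z.t z.x = 1 / 8 * (expSum (deriv p) (deriv q) z / expDiff p q z) :=
  fun _ hz => h.eq _ hz.1 _ hz.2.1

theorem isParameter : B.IsParameter β := by
  obtain ⟨z₀, hz₀⟩ := B.carrier_nonempty
  refine ⟨(smoothLT_parameter h.smooth_p h.smooth_q h.expDiff_ne_zero
    h.eq_expSum_div).contDiffOn_tx hz₀, fun t ht x hx => ?_⟩
  obtain ⟨z, hz, rfl, rfl⟩ := exists_mem_carrier ht hx
  have h1 := pd_x_parameter h.smooth_p h.smooth_q h.expDiff_ne_zero h.eq_expSum_div hz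
  have h2 : deriv (β z.t) z.x = pd .x (fun z => β z.t z.x) z := rfl
  rw [h2, h1]
  exact mul_ne_zero (by norm_num)
    (div_ne_zero (h.deriv_mul_ne_zero _ ht) (pow_ne_zero 2 (h.expDiff_ne_zero z hz)))

theorem smoothLT_expSum : B.SmoothLT 0 (expSum p q) :=
  JetBox.smoothLT_expSum h.smooth_p h.smooth_q

theorem pd_t_expSum : ∀ z ∈ B.carrier,
    pd .t (expSum p q) z = 4 * β z.t z.x * pd .x (expSum p q) z := by
  intro z hz
  rw [JetBox.pd_t_expSum h.smooth_p h.smooth_q hz, pd_x_expSum, h.eq_expSum_div z hz]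
  have h0 := h.expDiff_ne_zero z hz
  field_simp
  ring

theorem isConservationLaw (hB : (0 : ℝ) ∉ B.U 0) :
    B.IsConservationLaw (evolutionRHS β) (specialDensity p q) (specialFlux p q) := by
  rw [evolutionRHS_eq_jetRHS]
  refine (isConservationLaw_div_u hB h.isParameter.smoothLT h.smoothLT_expSum
    (fun z _ => pd_x_pd_x_expSum p q z) h.pd_t_expSum).congr (fun _ _ => by rw [specialDensity_eq]) fun z hz => ?_
  simp only
  rw [pd_x_parameter h.smooth_p h.smooth_q h.expDiff_ne_zero h.eq_expSum_div hz,
    pd_x_pd_x_parameter h.smooth_p h.smooth_q h.expDiff_ne_zero h.eq_expSum_div hz,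
    pd_x_expSum, h.eq_expSum_div z hz]
  have h0 := h.expDiff_ne_zero z hz
  have e4 : Real.exp (4 * z.x) = Real.exp (2 * z.x) ^ 2 := by
    rw [← Real.exp_nat_mul]; congr 1; push_cast; ring
  have e4' : Real.exp (-4 * z.x) = Real.exp (-2 * z.x) ^ 2 := by
    rw [← Real.exp_nat_mul]; congr 1; push_cast; ring
  -- With S = `expSum p q` and D = `expDiff p q`, the coefficient h_x β_x - h β_xx of u in the flux
  -- is -(pq)_t (D² + 2S²)/D³ for h = S.
  have e5 : 3 * p z.t ^ 2 * Real.exp (4 * z.x) + 2 * p z.t * q z.t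
      + 3 * q z.t ^ 2 * Real.exp (-4 * z.x) = expDiff p q z ^ 2 + 2 * expSum p q z ^ 2 := by
    rw [e4, e4', expDiff, expSum]
    linear_combination (-2 * p z.t * q z.t) * exp_two_mul_exp_neg_two z.x
  rw [specialFlux, e5]
  change 1 / 2 * (deriv (fun s => p s * q s) z.t * expSum p q z / expDiff p q z ^ 2) * z.u 1
    + 1 / 2 * (expSum (deriv p) (deriv q) z * expSum p q z / expDiff p q z) * (1 / z.u 0)
    - deriv (fun s => p s * q s) z.t * (expDiff p q z ^ 2 + 2 * expSum p q z ^ 2)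
      / expDiff p q z ^ 3 * z.u 0 = _
  have hu := u_zero_ne_zero hB hz
  field_simp
  ring

theorem eq_zero_of_isTrivialLaw_const_mul (hB : (0 : ℝ) ∉ B.U 0) {c : ℝ}
    (ht : B.IsTrivialLaw F (fun z => c * specialDensity p q z) σ) : c = 0 := by
  by_contra hc
  have hs : B.SmoothLT 0 fun z => c * expSum p q z := (SmoothLT.const 0 c).mul h.smoothLT_expSum
  have ht' : B.IsTrivialLaw F (fun z => c * expSum p q z * (1 / z.u 0)) σ :=
    ht.congr (fun z _ => by simp only [specialDensity_eq, mul_assoc]) fun _ _ => rfl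
  have h0 : Set.EqOn (fun z => c * expSum p q z) (fun _ => 0) B.carrier :=
    fun z hz => eq_zero_of_isTrivialLaw_div_u hB hs ht' hz
  obtain ⟨z, hz⟩ := B.carrier_nonempty
  -- The hypotheses exclude zeros of `expDiff`, not of `expSum`; hence the passage to the
  -- x-derivative.
  have h1 := pd_congr h0 .x hz
  rw [pd_const, pd_const_mul, pd_x_expSum] at h1
  exact mul_ne_zero hc (mul_ne_zero two_ne_zero (h.expDiff_ne_zero z hz)) h1

theorem not_isTrivialLaw (hB : (0 : ℝ) ∉ B.U 0) : ¬ B.IsTrivialLaw F (specialDensity p q) σ :=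
  fun ht => one_ne_zero (h.eq_zero_of_isTrivialLaw_const_mul hB (c := 1) (F := F) (σ := σ)
    (ht.congr (fun _ _ => one_mul _) fun _ _ => rfl))

theorem existsUnique_isTrivialLaw_sub (hB : (0 : ℝ) ∉ B.U 0)
    (hl : B.IsConservationLaw (evolutionRHS β) ρ σ) :
    ∃! c : ℝ, B.IsTrivialLaw (evolutionRHS β) (fun z => ρ z - c * specialDensity p q z)
      (fun z => σ z - c * specialFlux p q z) := by
  have hb := h.isParameter.smoothLT
  have hbx : ∀ z ∈ B.carrier, pd .x (fun z => β z.t z.x) z ≠ 0 :=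
    fun z hz => h.isParameter.pd_x_ne_zero hz
  have hs := h.smoothLT_expSum
  have hl' := hl
  rw [evolutionRHS_eq_jetRHS] at hl'
  obtain ⟨k, n, f, hk, hf, hρ, hkeq⟩ := hl'.exists_density hB hb hbx
  obtain ⟨z₀, hz₀⟩ := B.carrier_nonempty
  -- This c makes the x-derivative of k - c · `expSum p q` vanish at z₀; by rigidity the difference
  -- vanishes everywhere.
  set c : ℝ := pd .x k z₀ / (2 * expDiff p q z₀) with hc
  have hcs : B.SmoothLT 0 fun z => c * expSum p q z := (SmoothLT.const 0 c).mul hs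
  have hd : ∀ (i : JetCoord), ∀ z ∈ B.carrier, pd i (fun z => k z - c * expSum p q z) z =
      pd i k z - c * pd i (expSum p q) z := fun i z hz => by
    rw [pd_sub hk hcs _ hz, pd_const_mul]
  have hkc : ∀ z ∈ B.carrier, k z - c * expSum p q z = 0 := fun z hz => by
    refine SmoothLT.eq_zero_of_pd_x_eq_zero hb hbx (hk.sub hcs) (fun z hz => ?_) (fun z hz => ?_)
      hz₀ ?_ hz
    · rw [pd_congr (hd .x) _ hz,
        pd_sub (hk.smooth_pd _) ((SmoothLT.const 0 c).mul (hs.smooth_pd .x)) _ hz, pd_const_mul,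
        (hkeq z hz).1, pd_x_pd_x_expSum]
      ring
    · rw [hd .t z hz, hd .x z hz, (hkeq z hz).2, h.pd_t_expSum z hz]
      ring
    · have h0 := h.expDiff_ne_zero z₀ hz₀
      rw [hd .x z₀ hz₀, pd_x_expSum, hc]
      field_simp
      ring
  have hF : B.SmoothLT 3 (evolutionRHS β) := by
    rw [evolutionRHS_eq_jetRHS]
    exact hb.jetRHS
  have hct : B.IsTrivialLaw (evolutionRHS β) (fun z => ρ z - c * specialDensity p q z)
      (fun z => σ z - c * specialFlux p q z) := by
    refine IsConservationLaw.isTrivialLaw hF (hl.sub ((h.isConservationLaw hB).const_mul c)) hf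
      fun z hz => ?_
    rw [specialDensity_eq]
    linear_combination hρ z hz + (1 / z.u 0) * hkc z hz
  refine ⟨c, hct, fun c' hc' => ?_⟩
  have := h.eq_zero_of_isTrivialLaw_const_mul hB (c := c' - c)
    ((hct.sub hc').congr (fun z _ => by ring) fun _ _ => rfl)
  linarith

end IsSpecialParameter

/-- A nonzero solution of `h_xx = 4 h`, `h_t = 4 β h_x` yields a special form of `β`. -/
theorem IsParameter.exists_isSpecialParameter (hβ : B.IsParameter β) {h : JetPoint → ℝ}
    (hh : B.SmoothLT 0 h) (hhx : ∀ z ∈ B.carrier, pd .x (pd .x h) z = 4 * h z)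
    (hht : ∀ z ∈ B.carrier, pd .t h z = 4 * β z.t z.x * pd .x h z)
    (hne : ∃ z ∈ B.carrier, h z ≠ 0) : ∃ p q, B.IsSpecialParameter β p q := by
  obtain ⟨z₁, hz₁, h1⟩ := hne
  have hy : B.SmoothLT 0 (pd .x h) := hh.smooth_pd .x
  have hyne : ∀ z ∈ B.carrier, pd .x h z ≠ 0 := fun z hz h0 => h1 <|
    SmoothLT.eq_zero_of_pd_x_eq_zero hβ.smoothLT (fun z hz => hβ.pd_x_ne_zero hz) hh hhx hht hz h0
      hz₁
  obtain ⟨a, ha⟩ := B.nonempty_J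
  -- Since c² = 4, (h + h_x/c) e^{-cx} does not depend on x. The values c = 2 and c = -2 produce p
  -- and q.
  have key : ∀ c : ℝ, c ^ 2 = 4 → ∃ r : ℝ → ℝ, ContDiffOn ℝ ∞ r B.I ∧ ∀ z ∈ B.carrier,
      (h z + pd .x h z / c) / 2 = r z.t * Real.exp (c * z.x) := fun c hc => by
    have hc0 : c ≠ 0 := by rintro rfl; norm_num at hc
    have hE : B.SmoothLT 0 fun z => Real.exp (-c * z.x) := smoothLT_exp_mul_x (-c)
    have hEx : ∀ z, pd .x (fun z => Real.exp (-c * z.x)) z = Real.exp (-c * z.x) * -c := fun z =>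
      (((hasDerivAt_id z.x).const_mul (-c)).exp.congr_deriv (by simp)).deriv
    have hg : B.SmoothLT 0 fun z => c * h z + pd .x h z := ((SmoothLT.const 0 c).mul hh).add hy
    have hR : B.SmoothLT 0 fun z => (1 / (2 * c)) * ((c * h z + pd .x h z) * Real.exp (-c * z.x)) :=
      (SmoothLT.const 0 _).mul (hg.mul hE)
    refine ⟨fun t => (1 / (2 * c)) * ((c * h ⟨t, a, z₁.u⟩ + pd .x h ⟨t, a, z₁.u⟩) *
      Real.exp (-c * a)), ?_, fun z hz => ?_⟩
    · exact (hR.contDiffOn_tx hz₁).comp (f := fun t => (t, a)) (ContDiff.contDiffOn (by fun_prop))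
        fun t ht => ⟨ht, ha⟩
    · have e1 := hR.eq_set_of_pd_eq_zero (i := .x) (fun z hz => by
        rw [pd_const_mul, pd_mul hg hE _ hz, hEx, pd_add ((SmoothLT.const 0 c).mul hh) hy _ hz,
          pd_const_mul, hhx z hz]
        linear_combination (-1 / (2 * c) * h z * Real.exp (-c * z.x)) * hc) hz ha
      have e2 := hR.eq_of_tx (z := z.set .x a) (z' := ⟨z.t, a, z₁.u⟩) (set_mem hz ha)
        ⟨hz.1, ha, hz₁.2.2⟩ rfl rfl
      simp only at e2 ⊢
      rw [← e2, e1, neg_mul, Real.exp_neg]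
      have := Real.exp_ne_zero (c * z.x)
      field_simp
  obtain ⟨p, hp, hpeq⟩ := key 2 (by norm_num)
  obtain ⟨q, hq, hqeq⟩ := key (-2) (by norm_num)
  have hS : Set.EqOn h (expSum p q) B.carrier := fun z hz => by
    rw [expSum, ← hpeq z hz, ← hqeq z hz]; ring
  have hSx : ∀ z ∈ B.carrier, pd .x h z = 2 * expDiff p q z := fun z hz => by
    rw [expDiff, ← hpeq z hz, ← hqeq z hz]; ring
  have hD : ∀ z ∈ B.carrier, expDiff p q z ≠ 0 := fun z hz h0 => hyne z hz (by
    rw [hSx z hz, h0, mul_zero])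
  have hb : ∀ z ∈ B.carrier,
      β z.t z.x = 1 / 8 * (expSum (deriv p) (deriv q) z / expDiff p q z) := fun z hz => by
    have e1 := hht z hz
    rw [pd_congr hS _ hz, pd_t_expSum hp hq hz, hSx z hz] at e1
    have h0 := hD z hz
    rw [e1]
    field_simp
    ring
  refine ⟨p, q, hp, hq, fun t ht h0 => ?_, fun t ht x hx => ?_, fun t ht x hx => ?_⟩
  · obtain ⟨z, hz, rfl, -⟩ := exists_mem_carrier ht ha
    -- A zero of (pq)_t would be a zero of β_x.
    refine hβ.pd_x_ne_zero hz ?_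
    rw [pd_x_parameter hp hq hD hb hz, h0]
    simp
  · obtain ⟨z, hz, rfl, rfl⟩ := exists_mem_carrier ht hx
    exact hD z hz
  · obtain ⟨z, hz, rfl, rfl⟩ := exists_mem_carrier ht hx
    exact hb z hz

theorem IsParameter.exists_isSpecialParameter_of_not_isTrivialLaw (hβ : B.IsParameter β)
    (hB : (0 : ℝ) ∉ B.U 0) (hl : B.IsConservationLaw (evolutionRHS β) ρ σ)
    (hnt : ¬ B.IsTrivialLaw (evolutionRHS β) ρ σ) : ∃ p q, B.IsSpecialParameter β p q := by
  rw [evolutionRHS_eq_jetRHS] at hl hnt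
  obtain ⟨h, n, f, hh, hf, hρ, heq⟩ := hl.exists_density hB hβ.smoothLT
    fun z hz => hβ.pd_x_ne_zero hz
  refine hβ.exists_isSpecialParameter hh (fun z hz => (heq z hz).1) (fun z hz => (heq z hz).2) ?_
  by_contra! h0
  refine hnt (hl.isTrivialLaw hβ.smoothLT.jetRHS hf fun z hz => ?_)
  have := hρ z hz
  rw [h0 z hz] at this
  linarith

end JetBox

end

theorem mainTheorem2 (B : JetBox) (hB : (0 : ℝ) ∉ B.U 0) (β : ℝ → ℝ → ℝ) :
    (B.IsParameter β →
      ((∃ ρ σ : JetPoint → ℝ, B.IsConservationLaw (evolutionRHS β) ρ σ ∧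
          ¬ B.IsTrivialLaw (evolutionRHS β) ρ σ) ↔
        ∃ p q : ℝ → ℝ, B.IsSpecialParameter β p q)) ∧
    (∀ p q : ℝ → ℝ, B.IsSpecialParameter β p q →
      B.IsParameter β ∧
      B.IsConservationLaw (evolutionRHS β) (specialDensity p q) (specialFlux p q) ∧
      ¬ B.IsTrivialLaw (evolutionRHS β) (specialDensity p q) (specialFlux p q) ∧
      ∀ ρ σ : JetPoint → ℝ, B.IsConservationLaw (evolutionRHS β) ρ σ →
        ∃! c : ℝ, B.IsTrivialLaw (evolutionRHS β)
          (fun z => ρ z - c * specialDensity p q z)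
          (fun z => σ z - c * specialFlux p q z)) := by
  refine ⟨fun hβ => ⟨?_, ?_⟩, fun p q h => ⟨h.isParameter, h.isConservationLaw hB,
    h.not_isTrivialLaw hB, fun ρ σ hl => h.existsUnique_isTrivialLaw_sub hB hl⟩⟩
  · rintro ⟨ρ, σ, hl, hnt⟩
    exact hβ.exists_isSpecialParameter_of_not_isTrivialLaw hB hl hnt
  · rintro ⟨p, q, h⟩
    exact ⟨_, _, h.isConservationLaw hB, h.not_isTrivialLaw hB⟩
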